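/- Let $L:\mathbb R^d\to\mathbb R$ be of class $C^2$ with $L_m:=\min_{\mathbb R^d}L>0$ and $C_L:=\sup_{x}\|\nabla^2L(x)\|_2<\infty$ (spectral norm), and let $X_*$ be the unique global minimizer of $L$, with $\det\nabla^2L(X_*)>0$. Let $X_{in}$ be an $\mathbb R^d$-valued random variable whose law has a density $f$ with respect to Lebesgue measure, where $f$ is compactly supported, continuous at $X_*$, and $f(X_*)>0$. Let $0<\varepsilon<1$. Then there is a function $E$, depending only on $L$, the law of $X_{in}$ and $\varepsilon$, such that $E(\beta)=O(1/\beta)$ as $\beta\to\infty$, $$-\frac1\beta\log\mathbb E e^{-\beta L(X_{in})}-\frac1\beta\log\varepsilon=L(X_*)+\frac d2\,\frac{\log\beta}{\beta}+E(\beta)\qquad(\beta>0),$$ and the following holds for all $\beta>0$, all integers $N\ge1$ and all real $\gamma,\zeta$ with $(\gamma-1)^2+\zeta^2<1$. On a probability space, let $X_0^1,\dots,X_0^N$ be i.i.d. with the law of $X_{in}$, let $\eta_n^l$ ($n\ge0$, $1\le l\le d$) be i.i.d. real random variables with $\mathbb E[\eta_n^l]=0$ and $\mathbb E|\eta_n^l|^2=\zeta^2$,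 let the families $(X_0^i)_i$ and $(\eta_n^l)_{n,l}$ be independent of each other, and let $X_n^i=(x_n^{i,1},\dots,x_n^{i,d})$ solve, almost surely, $$X_{n+1}^i=X_n^i-\gamma(X_n^i-\bar X_n^*)-\sum_{l=1}^d(x_n^{i,l}-\bar x_n^{*,l})\,\eta_n^l\,e_l,\qquad \bar X_n^*=(\bar x_n^{*,1},\dots,\bar x_n^{*,d})=\frac{\sum_{j=1}^N X_n^je^{-\beta L(X_n^j)}}{\sum_{j=1}^N e^{-\beta L(X_n^j)}},$$ for $n\ge0$ and $1\le i\le N$, where $e_1,\dots,e_d$ is the standard basis of $\mathbb R^d$. Put $\bar x_0^l:=\frac1N\sum_{i=1}^N x_0^{i,l}$ and assume $$(1-\varepsilon)\,\mathbb E\big[e^{-\beta L(X_{in})}\big]\ \ge\ \frac{2C_L\sqrt{\big(1+(1-\gamma)^2+\zeta^2\big)\big(\gamma^2+\zeta^2\big)}\;\beta e^{-\beta L_m}}{1-e^{-[1-(\gamma-1)^2-\zeta^2]}}\ \sum_{l=1}^d\mathbb E\max_{1\le i\le N}(x_0^{i,l}-\bar x_0^l)^2 .$$ Then there is a random variable $X_\infty$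 with $\lim_{n\to\infty}X_n^i=X_\infty$ almost surely for every $i$, and $$\operatorname*{ess\,inf}_{\omega}L(X_\infty)\le-\frac1\beta\log\mathbb E e^{-\beta L(X_{in})}-\frac1\beta\log\varepsilon ,\qquad \Big|\operatorname*{ess\,inf}_{\omega}L(X_\infty)-L(X_*)\Big|\le\frac d2\,\frac{\log\beta}{\beta}+E(\beta).$$ -/

import Mathlib

open MeasureTheory ProbabilityTheory Filter Topology Asymptotics

noncomputable section

namespace CBO

/-- The search space `ℝ^d` with the Euclidean norm. -/
abbrev Space (d : ℕ) : Type := EuclideanSpace ℝ (Fin d)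

/-- The Hessian matrix `∇²L(x)`, whose `(i, j)` entry is `∂ᵢ∂ⱼ L(x)`. -/
def hessian {d : ℕ} (L : Space d → ℝ) (x : Space d) : Matrix (Fin d) (Fin d) ℝ :=
  Matrix.of fun i j =>
    fderiv ℝ (fun y => fderiv ℝ L y (EuclideanSpace.single j 1)) x (EuclideanSpace.single i 1)

/-- The spectral norm of a square matrix (operator norm on Euclidean space). -/
def spectralNorm {d : ℕ} (A : Matrix (Fin d) (Fin d) ℝ) : ℝ :=
  ‖Matrix.toEuclideanCLM (n := Fin d) (𝕜 := ℝ) A‖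

/-- `L_m`, the minimal value of `L`. -/
def minValue {d : ℕ} (L : Space d → ℝ) : ℝ := ⨅ x, L x

/-- `C_L = sup_x ‖∇²L(x)‖₂`. -/
def hessianBound {d : ℕ} (L : Space d → ℝ) : ℝ := ⨆ x, spectralNorm (hessian L x)

/-- `L` is `C²` with positive minimum and bounded Hessian, and `Xstar` is its unique global
minimizer, at which the Hessian has positive determinant. -/
structure Objective {d : ℕ} (L : Space d → ℝ) (Xstar : Space d) : Prop where
  contDiff : ContDiff ℝ 2 L
  min_pos : 0 < minValue L
  hessian_bdd : BddAbove (Set.range fun x => spectralNorm (hessian L x))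
  unique_min : ∀ x, x ≠ Xstar → L Xstar < L x
  det_pos : 0 < (hessian L Xstar).det

/-- The random variable `Xin` has the probability density `f` with respect to Lebesgue measure;
`f` is compactly supported, continuous at `Xstar`, and positive there. -/
structure ReferenceLaw {d : ℕ} {Ω₀ : Type*} [MeasurableSpace Ω₀] (P₀ : Measure Ω₀)
    (Xin : Ω₀ → Space d) (f : Space d → ℝ) (Xstar : Space d) : Prop where
  measurable_var : Measurable Xin
  measurable_density : Measurable f
  density_nonneg : ∀ x, 0 ≤ f x
  law_eq : P₀.map Xin = volume.withDensity fun x => ENNReal.ofReal (f x)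
  compactSupport : HasCompactSupport f
  continuousAt : ContinuousAt f Xstar
  pos : 0 < f Xstar

/-- The weighted average `(∑ⱼ xⱼ exp (-β L(xⱼ))) / ∑ⱼ exp (-β L(xⱼ))`. -/
def weightedMean {d N : ℕ} (β : ℝ) (L : Space d → ℝ) (x : Fin N → Space d) : Space d :=
  (∑ j, Real.exp (-β * L (x j)))⁻¹ • ∑ j, Real.exp (-β * L (x j)) • x j

/-- The ensemble average `(1/N) ∑ⱼ xⱼ`. -/
def ensembleMean {d N : ℕ} (x : Fin N → Space d) : Space d := (N : ℝ)⁻¹ • ∑ j, x j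

/-- The noise variables `η n l` are i.i.d., square integrable, centred, with variance `ζ²`. -/
structure Noise {d : ℕ} {Ω : Type*} [MeasurableSpace Ω] (P : Measure Ω) (ζ : ℝ)
    (η : ℕ → Fin d → Ω → ℝ) : Prop where
  measurable : ∀ n l, Measurable (η n l)
  indep : iIndepFun (fun p : ℕ × Fin d => η p.1 p.2) P
  ident : ∀ n l n' l', IdentDistrib (η n l) (η n' l') P P
  memLp : ∀ n l, MemLp (η n l) 2 P
  mean : ∀ n l, ∫ ω, η n l ω ∂P = 0
  variance : ∀ n l, ∫ ω, (η n l ω) ^ 2 ∂P = ζ ^ 2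

/-- The initial positions are i.i.d. with the law of `Xin`, and are independent of the noise. -/
structure InitialData {d N : ℕ} {Ω Ω₀ : Type*} [MeasurableSpace Ω] [MeasurableSpace Ω₀]
    (P : Measure Ω) (P₀ : Measure Ω₀) (Xin : Ω₀ → Space d) (η : ℕ → Fin d → Ω → ℝ)
    (X0 : Fin N → Ω → Space d) : Prop where
  measurable : ∀ i, Measurable (X0 i)
  indep : iIndepFun X0 P
  ident : ∀ i, IdentDistrib (X0 i) Xin P P₀
  indep_noise :
    IndepFun (fun ω (i : Fin N) => X0 i ω) (fun ω (p : ℕ × Fin d) => η p.1 p.2 ω) P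

/-- The process `X n i` (time `n`, particle `i`) solves the discrete consensus-based
optimization scheme, almost surely. -/
def IsSolution {d N : ℕ} {Ω : Type*} [MeasurableSpace Ω] (P : Measure Ω) (L : Space d → ℝ)
    (β γ : ℝ) (η : ℕ → Fin d → Ω → ℝ) (X : ℕ → Fin N → Ω → Space d) : Prop :=
  ∀ᵐ ω ∂P, ∀ n i,
    X (n + 1) i ω =
      X n i ω - γ • (X n i ω - weightedMean β L (fun j => X n j ω))
        - ∑ l, ((X n i ω l - weightedMean β L (fun j => X n j ω) l) * η n l ω) •
            (EuclideanSpace.single l 1 : Space d)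

/-- The initial spread `∑_l E max_i (x₀^{i,l} - x̄₀^l)²`. -/
def initialSpread {d N : ℕ} {Ω : Type*} [MeasurableSpace Ω] (P : Measure Ω)
    (X0 : Fin N → Ω → Space d) : ℝ :=
  ∑ l : Fin d, ∫ ω, ⨆ i, (X0 i ω l - ensembleMean (fun j => X0 j ω) l) ^ 2 ∂P

end CBO

end

/-!
The Lyapunov function is the average Gibbs weight `N⁻¹ ∑ᵢ e^{-β L(Xᵢ)}`. When `L` is expanded around
the weighted mean, the first-order terms of one step, summed with the Gibbs weights, cancel; since
`∇L` is Lipschitz, the expected weight decreases by at most a constant times the expected spread of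
the ensemble. In each coordinate a step multiplies the differences between particles by
`1 - γ - η`, so the expected spread decays like `((1 - γ)² + ζ²)ⁿ`. The decreases form a geometric
series, which yields both almost sure consensus and `E e^{-β L(X∞)} ≥ ε E e^{-β L(X_in)}`. Taking
logarithms bounds `ess inf L(X∞)` by the free energy of the reference law, and Laplace's method at
the nondegenerate minimizer shows that this is `L(X⋆) + (d/2) β⁻¹ log β + O(β⁻¹)`.
-/

noncomputable section

namespace CBO

section SecondDerivative

variable {E F : Type*} [NormedAddCommGroup E] [NormedSpace ℝ E] [NormedAddCommGroup F]
  [NormedSpace ℝ F]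

theorem hasFDerivAt_sub_quadratic {f : E → F} {a v : E}
    {B : E →L[ℝ] E →L[ℝ] F} (hB : ∀ u v, B u v = B v u) (hf : DifferentiableAt ℝ f (a + v)) :
    HasFDerivAt (fun w => f (a + w) - fderiv ℝ f a w - (1 / 2 : ℝ) • B w w)
      (fderiv ℝ f (a + v) - fderiv ℝ f a - B v) v := by
  have hquad : HasFDerivAt (fun w => B w w) ((2 : ℝ) • B v) v := by
    refine (B.hasFDerivAt.clm_apply (hasFDerivAt_id v)).congr_fderiv ?_
    ext u
    simp [hB u v, two_smul]
  have hshift : HasFDerivAt (fun w => f (a + w)) (fderiv ℝ f (a + v)) v :=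
    (hasFDerivAt_comp_add_left a).2 hf.hasFDerivAt
  refine ((hshift.sub (fderiv ℝ f a).hasFDerivAt).sub
    (hquad.const_smul (1 / 2 : ℝ))).congr_fderiv ?_
  rw [smul_smul]
  norm_num

theorem taylor_two_isLittleO {f : E → F} {a : E} (hf : ContDiffAt ℝ 2 f a) :
    (fun v => f (a + v) - f a - fderiv ℝ f a v - (1 / 2 : ℝ) • fderiv ℝ (fderiv ℝ f) a v v)
      =o[𝓝 0] fun v => ‖v‖ ^ 2 := by
  set B := fderiv ℝ (fderiv ℝ f) a
  have hsymm : ∀ u v, B u v = B v u := fun u v => (hf.isSymmSndFDerivAt (by simp)).eq u v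
  have hdiff : ∀ᶠ w in 𝓝 (0 : E), DifferentiableAt ℝ f (a + w) :=
    (continuous_const_add a).tendsto' 0 a (add_zero a) |>.eventually
      ((hf.eventually (by simp)).mono fun _ h => h.differentiableAt (by norm_num))
  have hlin : (fun w => fderiv ℝ f (a + w) - fderiv ℝ f a - B w) =o[𝓝 0] fun w => w :=
    hasFDerivAt_iff_isLittleO_nhds_zero.1
      ((hf.fderiv_right (m := 1) (by norm_num)).differentiableAt (by norm_num)).hasFDerivAt
  refine isLittleO_iff.2 fun δ hδ => ?_
  obtain ⟨r, hr, hball⟩ := Metric.eventually_nhds_iff_ball.1 (hdiff.and (hlin.def hδ))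
  filter_upwards [Metric.ball_mem_nhds 0 hr] with v hv
  have hsub : ∀ w ∈ Metric.closedBall (0 : E) ‖v‖, w ∈ Metric.ball (0 : E) r := fun w hw => by
    rw [mem_ball_zero_iff] at hv ⊢
    exact (mem_closedBall_zero_iff.1 hw).trans_lt hv
  have hmean := (convex_closedBall (0 : E) ‖v‖).norm_image_sub_le_of_norm_hasFDerivWithin_le
    (𝕜 := ℝ) (C := δ * ‖v‖) (x := 0) (y := v)
    (fun w hw => (hasFDerivAt_sub_quadratic hsymm (hball w (hsub w hw)).1).hasFDerivWithinAt)
    (fun w hw => (hball w (hsub w hw)).2.trans (by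
      gcongr
      exact mem_closedBall_zero_iff.1 hw)) (by simp) (by simp)
  simp only [add_zero, map_zero, sub_zero, smul_zero] at hmean
  rw [Real.norm_of_nonneg (by positivity), sq, ← mul_assoc]
  refine le_of_eq_of_le ?_ hmean
  congr 1
  abel

theorem fderiv_fderiv_nonneg_of_isLocalMin {f : E → ℝ} {a : E} (hf : ContDiffAt ℝ 2 f a)
    (hmin : IsLocalMin f a) (v : E) : 0 ≤ fderiv ℝ (fderiv ℝ f) a v v := by
  set B := fderiv ℝ (fderiv ℝ f) a
  have hline : Tendsto (fun t : ℝ => t • v) (𝓝[≠] 0) (𝓝 0) :=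
    ((continuous_id.smul continuous_const).tendsto' 0 0 (zero_smul ℝ v)).mono_left
      nhdsWithin_le_nhds
  have hmin' : ∀ᶠ t : ℝ in 𝓝[≠] 0, f a ≤ f (a + t • v) :=
    (((continuous_const_add a).tendsto' 0 a (add_zero a)).comp hline).eventually hmin
  have hrem : Tendsto (fun t : ℝ => (f (a + t • v) - f a) / t ^ 2) (𝓝[≠] 0) (𝓝 (B v v / 2)) := by
    have hO : (fun t : ℝ => ‖t • v‖ ^ 2) =O[𝓝[≠] 0] fun t => t ^ 2 :=
      IsBigO.of_bound (‖v‖ ^ 2) (Eventually.of_forall fun t => by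
        simp [norm_smul, mul_pow, mul_comm])
    have h := ((taylor_two_isLittleO hf).comp_tendsto hline).trans_isBigO hO
    simp only [hmin.fderiv_eq_zero] at h
    refine (zero_add (B v v / 2) ▸ h.tendsto_div_nhds_zero.add_const (B v v / 2)).congr' ?_
    filter_upwards [self_mem_nhdsWithin] with t ht
    have : t ≠ 0 := ht
    simp only [Function.comp, map_smul, smul_apply, smul_eq_mul, zero_apply]
    field_simp
    ring
  have hnonneg : 0 ≤ B v v / 2 := ge_of_tendsto hrem <| hmin'.mono fun t ht =>
    div_nonneg (sub_nonneg.2 ht) (sq_nonneg t)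
  linarith

theorem isCoercive_of_pos [FiniteDimensional ℝ E] {B : E →L[ℝ] E →L[ℝ] ℝ}
    (hB : ∀ v, v ≠ 0 → 0 < B v v) : IsCoercive B := by
  obtain ⟨C, hC, hsphere⟩ : ∃ C > 0, ∀ u ∈ Metric.sphere (0 : E) 1, C ≤ B u u := by
    rcases (Metric.sphere (0 : E) 1).eq_empty_or_nonempty with hempty | hne
    · exact ⟨1, one_pos, by simp [hempty]⟩
    · obtain ⟨u, hu, hmin⟩ := (isCompact_sphere (0 : E) 1).exists_isMinOn hne
        (f := fun v => B v v) (by fun_prop)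
      exact ⟨B u u, hB u (ne_zero_of_mem_unit_sphere ⟨u, hu⟩), fun v hv => hmin hv⟩
  refine ⟨C, hC, fun v => ?_⟩
  rcases eq_or_ne v 0 with rfl | hv
  · simp
  have hv' := norm_ne_zero_iff.2 hv
  have hunit := hsphere (‖v‖⁻¹ • v) (by simp [norm_smul, inv_mul_cancel₀ hv'])
  simp only [map_smul, smul_apply, smul_eq_mul] at hunit
  calc C * ‖v‖ * ‖v‖ ≤ (‖v‖⁻¹ * (‖v‖⁻¹ * B v v)) * ‖v‖ * ‖v‖ := by gcongr
    _ = B v v := by field_simp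

theorem isBigO_sq_of_fderiv_eq_zero {f : E → F} {a : E} (hf : ContDiffAt ℝ 2 f a)
    (ha : fderiv ℝ f a = 0) : (fun v => f (a + v) - f a) =O[𝓝 0] fun v => ‖v‖ ^ 2 := by
  set B := fderiv ℝ (fderiv ℝ f) a
  have hB : (fun v => (1 / 2 : ℝ) • B v v) =O[𝓝 0] fun v => ‖v‖ ^ 2 :=
    (IsBigO.of_bound ‖B‖ (Eventually.of_forall fun v => by
      simpa [sq, mul_assoc] using B.le_opNorm₂ v v)).const_smul_left _
  refine ((taylor_two_isLittleO hf).isBigO.add hB).congr_left fun v => ?_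
  simp [ha, B]

theorem exists_mul_sq_le_of_isCoercive {f : E → ℝ} {a : E} (hf : ContDiffAt ℝ 2 f a)
    (ha : fderiv ℝ f a = 0) (hB : IsCoercive (fderiv ℝ (fderiv ℝ f) a)) :
    ∃ c > 0, ∀ᶠ v in 𝓝 0, c * ‖v‖ ^ 2 ≤ f (a + v) - f a := by
  obtain ⟨c, hc, hcoer⟩ := hB
  refine ⟨c / 4, by positivity, ?_⟩
  filter_upwards [(taylor_two_isLittleO hf).def (c := c / 4) (by positivity)] with v hv
  simp only [ha, zero_apply, sub_zero, smul_eq_mul, Real.norm_eq_abs, abs_pow, abs_norm] at hv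
  linarith [(abs_le.1 hv).1, hcoer v, show c * ‖v‖ * ‖v‖ = c * ‖v‖ ^ 2 by ring]

theorem sub_le_of_lipschitzWith_fderiv {f : E → ℝ} {K : NNReal} (hf : Differentiable ℝ f)
    (hLip : LipschitzWith K (fderiv ℝ f)) (x y z : E) {s : ℝ} (hs : 0 < s) :
    f y - f x ≤ fderiv ℝ f z (y - x)
      + K * (s / 2 * (‖x - z‖ ^ 2 + ‖y - z‖ ^ 2) + ‖y - x‖ ^ 2 / (2 * s)) := by
  set R := max ‖x - z‖ ‖y - z‖
  have hmean : |f y - f x - fderiv ℝ f z (y - x)| ≤ K * R * ‖y - x‖ := by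
    refine (convex_closedBall z R).norm_image_sub_le_of_norm_fderiv_le' (𝕜 := ℝ)
      (fun w _ => hf w) (fun w hw => ?_) (mem_closedBall_iff_norm.2 (le_max_left _ _))
      (mem_closedBall_iff_norm.2 (le_max_right _ _))
    refine (hLip.norm_sub_le w z).trans ?_
    gcongr
    exact mem_closedBall_iff_norm.1 hw
  have hR : R ^ 2 ≤ ‖x - z‖ ^ 2 + ‖y - z‖ ^ 2 := by
    rcases max_cases ‖x - z‖ ‖y - z‖ with ⟨h, -⟩ | ⟨h, -⟩ <;>
      simp only [R, h] <;> nlinarith [sq_nonneg ‖x - z‖, sq_nonneg ‖y - z‖]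
  have hyoung : R * ‖y - x‖ ≤ s / 2 * R ^ 2 + ‖y - x‖ ^ 2 / (2 * s) := by
    have h : s / 2 * R ^ 2 + ‖y - x‖ ^ 2 / (2 * s) - R * ‖y - x‖
        = (s * R - ‖y - x‖) ^ 2 / (2 * s) := by field_simp; ring
    linarith [show 0 ≤ (s * R - ‖y - x‖) ^ 2 / (2 * s) by positivity]
  calc f y - f x ≤ fderiv ℝ f z (y - x) + K * (R * ‖y - x‖) := by
        linarith [(abs_le.1 hmean).2, mul_assoc (K : ℝ) R ‖y - x‖]
    _ ≤ _ := by
        gcongr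
        exact hyoung.trans (by gcongr)

end SecondDerivative

theorem exists_mul_sq_le_on_isCompact {E : Type*} [NormedAddCommGroup E] {φ : E → ℝ} {a : E}
    {K : Set E} (hK : IsCompact K) (hφ : Continuous φ) (hpos : ∀ x, x ≠ a → 0 < φ x)
    (hnear : ∃ c > 0, ∀ᶠ v in 𝓝 0, c * ‖v‖ ^ 2 ≤ φ (a + v)) :
    ∃ c > 0, ∀ x ∈ K, c * ‖x - a‖ ^ 2 ≤ φ x := by
  refine hK.induction_on (p := fun S => ∃ c > 0, ∀ x ∈ S, c * ‖x - a‖ ^ 2 ≤ φ x)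
    ⟨1, one_pos, by simp⟩ (fun S T hST ⟨c, hc, h⟩ => ⟨c, hc, fun x hx => h x (hST hx)⟩) ?_ ?_
  · rintro S T ⟨c, hc, hS⟩ ⟨c', hc', hT⟩
    refine ⟨min c c', lt_min hc hc', ?_⟩
    rintro x (hx | hx)
    · exact le_trans (by gcongr; exact min_le_left _ _) (hS x hx)
    · exact le_trans (by gcongr; exact min_le_right _ _) (hT x hx)
  · intro x _
    suffices ∃ c > 0, ∀ᶠ y in 𝓝 x, c * ‖y - a‖ ^ 2 ≤ φ y by
      obtain ⟨c, hc, h⟩ := this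
      exact ⟨_, mem_nhdsWithin_of_mem_nhds h, c, hc, fun _ hy => hy⟩
    rcases eq_or_ne x a with rfl | hx
    · obtain ⟨c, hc, h⟩ := hnear
      have hshift : Tendsto (fun y => y - x) (𝓝 x) (𝓝 0) :=
        (continuous_sub_right x).tendsto' x 0 (sub_self x)
      exact ⟨c, hc, (hshift.eventually h).mono fun y hy => by simpa using hy⟩
    · have hφx := hpos x hx
      have hax : 0 < ‖x - a‖ := norm_pos_iff.2 (sub_ne_zero.2 hx)
      refine ⟨φ x / (2 * ‖x - a‖ ^ 2), by positivity, ?_⟩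
      have hlt : φ x / (2 * ‖x - a‖ ^ 2) * ‖x - a‖ ^ 2 < φ x := by
        field_simp
        norm_num
      exact (ContinuousAt.eventually_lt (by fun_prop) hφ.continuousAt hlt).mono fun _ h => h.le

section Hessian

variable {d : ℕ} {L : Space d → ℝ} {x : Space d}

theorem hessian_apply (hL : DifferentiableAt ℝ (fderiv ℝ L) x) (i j : Fin d) :
    hessian L x i j = fderiv ℝ (fderiv ℝ L) x (EuclideanSpace.single i 1)
      (EuclideanSpace.single j 1) := by
  have h := hL.hasFDerivAt.clm_apply (hasFDerivAt_const (EuclideanSpace.single j (1 : ℝ)) x)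
  simp [hessian, h.fderiv]

theorem inner_hessian (hL : DifferentiableAt ℝ (fderiv ℝ L) x) (u v : Space d) :
    inner ℝ u (Matrix.toEuclideanCLM (n := Fin d) (𝕜 := ℝ) (hessian L x) v)
      = fderiv ℝ (fderiv ℝ L) x u v := by
  have hbasis : ∀ w : Space d, w = ∑ i, w i • (EuclideanSpace.single i (1 : ℝ) : Space d) :=
    fun w => by simpa using ((EuclideanSpace.basisFun (Fin d) ℝ).sum_repr w).symm
  conv_rhs => rw [hbasis u, hbasis v]
  simp only [map_sum, map_smul, FunLike.coe_sum, Finset.sum_apply, smul_apply, smul_eq_mul,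
    ← hessian_apply hL, EuclideanSpace.inner_eq_star_dotProduct, Matrix.ofLp_toEuclideanCLM,
    dotProduct, Matrix.mulVec, Finset.sum_mul, Finset.mul_sum, star_trivial, Pi.star_apply]
  rw [Finset.sum_comm]
  refine Finset.sum_congr rfl fun i _ => Finset.sum_congr rfl fun j _ => ?_
  ring

theorem dotProduct_hessian (hL : DifferentiableAt ℝ (fderiv ℝ L) x) (v : Fin d → ℝ) :
    star v ⬝ᵥ (hessian L x).mulVec v
      = fderiv ℝ (fderiv ℝ L) x (WithLp.toLp 2 v) (WithLp.toLp 2 v) := by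
  rw [← inner_hessian hL, EuclideanSpace.inner_eq_star_dotProduct, dotProduct_comm]
  simp [star_trivial]

theorem hessian_posSemidef_of_isLocalMin (hL : ContDiffAt ℝ 2 L x) (hmin : IsLocalMin L x) :
    (hessian L x).PosSemidef := by
  have hdiff : DifferentiableAt ℝ (fderiv ℝ L) x :=
    (hL.fderiv_right (m := 1) (by norm_num)).differentiableAt (by norm_num)
  refine Matrix.PosSemidef.of_dotProduct_mulVec_nonneg ?_ fun v => ?_
  · ext i j
    simpa [hessian_apply hdiff] using (hL.isSymmSndFDerivAt (by simp)).eq _ _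
  · rw [dotProduct_hessian hdiff]
    exact fderiv_fderiv_nonneg_of_isLocalMin hL hmin _

theorem isCoercive_of_hessian_posDef (hL : DifferentiableAt ℝ (fderiv ℝ L) x)
    (hpos : (hessian L x).PosDef) : IsCoercive (fderiv ℝ (fderiv ℝ L) x) :=
  isCoercive_of_pos fun v hv => by
    rw [← WithLp.toLp_ofLp 2 v, ← dotProduct_hessian hL]
    exact hpos.dotProduct_mulVec_pos (by simpa using hv)

theorem exists_mul_sq_le_of_isLocalMin (hL : ContDiffAt ℝ 2 L x) (hmin : IsLocalMin L x)
    (hdet : (hessian L x).det ≠ 0) :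
    ∃ c > 0, ∀ᶠ v in 𝓝 0, c * ‖v‖ ^ 2 ≤ L (x + v) - L x :=
  exists_mul_sq_le_of_isCoercive hL hmin.fderiv_eq_zero <|
    isCoercive_of_hessian_posDef
      ((hL.fderiv_right (m := 1) (by norm_num)).differentiableAt (by norm_num))
      ((hessian_posSemidef_of_isLocalMin hL hmin).posDef_iff_det_ne_zero.2 hdet)

theorem hessianBound_nonneg : 0 ≤ hessianBound L :=
  Real.iSup_nonneg fun _ => norm_nonneg _

theorem norm_fderiv_fderiv_le (hL : DifferentiableAt ℝ (fderiv ℝ L) x) :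
    ‖fderiv ℝ (fderiv ℝ L) x‖ ≤ spectralNorm (hessian L x) := by
  refine ContinuousLinearMap.opNorm_le_bound₂ _ (norm_nonneg _) fun u v => ?_
  rw [← inner_hessian hL, mul_right_comm, mul_comm, mul_comm _ ‖v‖, mul_comm ‖v‖]
  exact (norm_inner_le_norm _ _).trans (by
    gcongr
    exact ContinuousLinearMap.le_opNorm _ _)

theorem lipschitzWith_fderiv (hL : ContDiff ℝ 2 L)
    (hbdd : BddAbove (Set.range fun x => spectralNorm (hessian L x))) :
    LipschitzWith (hessianBound L).toNNReal (fderiv ℝ L) := by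
  have hdiff : Differentiable ℝ (fderiv ℝ L) :=
    (hL.fderiv_right (m := 1) (by norm_num)).differentiable (by norm_num)
  refine lipschitzWith_of_nnnorm_fderiv_le hdiff fun x => ?_
  exact NNReal.le_toNNReal_of_coe_le ((norm_fderiv_fderiv_le (hdiff x)).trans (le_ciSup hbdd x))

end Hessian

/-- The free energy `-β⁻¹ log E e^{-βg}` of the observable `g` at inverse temperature `β`;
as `β → ∞` it approximates the essential infimum of `g` from above. -/
def freeEnergy {Ω : Type*} [MeasurableSpace Ω] (P : Measure Ω) (g : Ω → ℝ) (β : ℝ) : ℝ :=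
  -(1 / β) * Real.log (∫ ω, Real.exp (-β * g ω) ∂P)

theorem le_of_forall_ne_lt {α : Type*} {g : α → ℝ} {a : α} (h : ∀ x, x ≠ a → g a < g x) (x : α) :
    g a ≤ g x := by
  rcases eq_or_ne x a with rfl | hx
  exacts [le_rfl, (h x hx).le]

section Laplace

theorem isBigO_log_sub_log {α : Type*} {l : Filter α} {u v : α → ℝ} (h : u =Θ[l] v) :
    (fun x => Real.log (u x) - Real.log (v x)) =O[l] fun _ => (1 : ℝ) := by
  obtain ⟨C, hC, huv⟩ := h.1.exists_pos
  obtain ⟨D, hD, hvu⟩ := h.2.exists_pos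
  refine IsBigO.of_bound (|Real.log C| + |Real.log D|) ?_
  filter_upwards [huv.bound, hvu.bound] with x hu hv
  rw [norm_one, mul_one, ← Real.log_abs (u x), ← Real.log_abs (v x)]
  rw [Real.norm_eq_abs, Real.norm_eq_abs] at hu hv
  rcases (abs_nonneg (v x)).eq_or_lt with hvx | hvx
  · have hux : |u x| = 0 := le_antisymm (by simpa [← hvx] using hu) (abs_nonneg _)
    rw [hux, ← hvx, sub_self, norm_zero]
    positivity
  have hux : 0 < |u x| := pos_of_mul_pos_right (hvx.trans_le hv) hD.le
  have hlogu := Real.log_le_log hux hu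
  have hlogv := Real.log_le_log hvx hv
  rw [Real.log_mul hC.ne' hvx.ne'] at hlogu
  rw [Real.log_mul hD.ne' hux.ne'] at hlogv
  rw [Real.norm_eq_abs, abs_le]
  constructor <;> linarith [le_abs_self (Real.log C), le_abs_self (Real.log D),
    abs_nonneg (Real.log C), abs_nonneg (Real.log D)]

theorem isBigO_freeEnergy_sub {Ω : Type*} [MeasurableSpace Ω] {P : Measure Ω} {g : Ω → ℝ}
    {c s : ℝ} (h : (fun β => ∫ ω, Real.exp (-β * (g ω - c)) ∂P) =Θ[atTop] fun β => β ^ (-s)) :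
    (fun β => freeEnergy P g β - (c + s * (Real.log β / β))) =O[atTop] fun β => 1 / β := by
  have hnonzero : ∀ᶠ β : ℝ in atTop, ∫ ω, Real.exp (-β * (g ω - c)) ∂P ≠ 0 := by
    filter_upwards [h.eq_zero_iff, eventually_gt_atTop 0] with β hβ hβ0
    exact hβ.not.2 (Real.rpow_pos_of_pos hβ0 _).ne'
  have hlog := (isBigO_log_sub_log h).mul (isBigO_refl (fun β : ℝ => 1 / β) atTop)
  refine (hlog.neg_left.congr' ?_ (Eventually.of_forall fun β => one_mul _))
  filter_upwards [hnonzero, eventually_gt_atTop 0] with β hβ hβ0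
  have hfactor : ∫ ω, Real.exp (-β * g ω) ∂P
      = Real.exp (-β * c) * ∫ ω, Real.exp (-β * (g ω - c)) ∂P := by
    rw [← integral_const_mul]
    congr with ω
    rw [← Real.exp_add]
    ring_nf
  rw [freeEnergy, hfactor, Real.log_mul (Real.exp_pos _).ne' hβ, Real.log_exp, Real.log_rpow hβ0]
  field_simp
  ring

section Gaussian

variable {E : Type*} [NormedAddCommGroup E] [InnerProductSpace ℝ E] [FiniteDimensional ℝ E]
  [MeasurableSpace E] [BorelSpace E]

theorem integrable_exp_neg_mul_sq_norm_sub {b : ℝ} (hb : 0 < b) (a : E) :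
    Integrable fun x : E => Real.exp (-b * ‖x - a‖ ^ 2) := by
  have h := (GaussianFourier.integrable_cexp_neg_mul_sq_norm_add (V := E) (b := (b : ℂ))
    (by simpa using hb) 0 0).norm
  refine (h.comp_sub_right a).congr (Eventually.of_forall fun x => ?_)
  simp only [Complex.norm_exp, zero_mul, add_zero]
  norm_cast

theorem integral_exp_neg_mul_sq_norm_sub {b : ℝ} (hb : 0 < b) (a : E) :
    ∫ x : E, Real.exp (-b * ‖x - a‖ ^ 2) = (Real.pi / b) ^ (Module.finrank ℝ E / 2 : ℝ) := by
  rw [integral_sub_right_eq_self (fun x : E => Real.exp (-b * ‖x‖ ^ 2)) a]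
  exact GaussianFourier.integral_rexp_neg_mul_sq_norm hb

theorem integral_exp_neg_mul_sq_norm_sub_le {μ : Measure E} [IsFiniteMeasure μ] {a : E}
    {r : ℝ} {M : ENNReal} (hM : M ≠ ⊤) (hr : 0 ≤ r)
    (hμ : μ.restrict (Metric.ball a r) ≤ M • volume) {b : ℝ} (hb : 0 < b) :
    ∫ x, Real.exp (-b * ‖x - a‖ ^ 2) ∂μ
      ≤ M.toReal * (Real.pi / b) ^ (Module.finrank ℝ E / 2 : ℝ)
        + μ.real Set.univ * Real.exp (-r ^ 2 * b) := by
  have hbdd : ∀ x, ‖Real.exp (-b * ‖x - a‖ ^ 2)‖ ≤ 1 := fun x => by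
    rw [Real.norm_of_nonneg (Real.exp_pos _).le, Real.exp_le_one_iff]
    nlinarith [sq_nonneg ‖x - a‖]
  have hint : Integrable (fun x => Real.exp (-b * ‖x - a‖ ^ 2)) μ :=
    (integrable_const (1 : ℝ)).mono' (by fun_prop) (Eventually.of_forall hbdd)
  rw [← integral_add_compl measurableSet_ball hint, ← integral_exp_neg_mul_sq_norm_sub hb a,
    ← smul_eq_mul M.toReal, ← integral_smul_measure]
  refine add_le_add (integral_mono_measure hμ (Eventually.of_forall fun x => (Real.exp_pos _).le)
    ((integrable_exp_neg_mul_sq_norm_sub hb a).smul_measure hM)) ?_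
  calc ∫ x in (Metric.ball a r)ᶜ, Real.exp (-b * ‖x - a‖ ^ 2) ∂μ
      ≤ ∫ _ in (Metric.ball a r)ᶜ, Real.exp (-r ^ 2 * b) ∂μ := by
        refine setIntegral_mono_on hint.integrableOn (integrable_const _)
          measurableSet_ball.compl fun x hx => ?_
        have hx' : r ≤ ‖x - a‖ := by simpa [dist_eq_norm] using hx
        have : r ^ 2 ≤ ‖x - a‖ ^ 2 := by gcongr
        exact Real.exp_le_exp.2 (by nlinarith)
    _ = μ.real (Metric.ball a r)ᶜ * Real.exp (-r ^ 2 * b) := by simp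
    _ ≤ μ.real Set.univ * Real.exp (-r ^ 2 * b) :=
        mul_le_mul_of_nonneg_right (measureReal_mono (Set.subset_univ _)) (Real.exp_pos _).le

theorem isBigO_integral_exp_neg_mul {μ : Measure E} [IsFiniteMeasure μ] {φ : E → ℝ} {a : E}
    {c r : ℝ} {M : ENNReal} (hc : 0 < c) (hr : 0 < r) (hM : M ≠ ⊤)
    (hμ : μ.restrict (Metric.ball a r) ≤ M • volume)
    (hφ : ∀ᵐ x ∂μ, c * ‖x - a‖ ^ 2 ≤ φ x) :
    (fun β => ∫ x, Real.exp (-β * φ x) ∂μ)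
      =O[atTop] fun β => β ^ (-(Module.finrank ℝ E / 2 : ℝ)) := by
  have hgauss : (fun β => M.toReal * (Real.pi / (β * c)) ^ (Module.finrank ℝ E / 2 : ℝ))
      =O[atTop] fun β => β ^ (-(Module.finrank ℝ E / 2 : ℝ)) := by
    refine IsBigO.const_mul_left (IsBigO.of_bound
      ((Real.pi / c) ^ (Module.finrank ℝ E / 2 : ℝ)) ?_) _
    filter_upwards [eventually_gt_atTop 0] with β hβ
    rw [Real.norm_of_nonneg (by positivity), Real.norm_of_nonneg (by positivity),
      Real.rpow_neg hβ.le, ← div_eq_mul_inv, ← Real.div_rpow (by positivity) hβ.le, div_div,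
      mul_comm]
  have htail : (fun β => μ.real Set.univ * Real.exp (-r ^ 2 * (β * c)))
      =O[atTop] fun β => β ^ (-(Module.finrank ℝ E / 2 : ℝ)) := by
    have h := isLittleO_exp_neg_mul_rpow_atTop (a := r ^ 2 * c) (by positivity)
      (-(Module.finrank ℝ E / 2 : ℝ))
    refine (h.isBigO.congr_left fun β => ?_).const_mul_left _
    ring_nf
  refine IsBigO.trans (IsBigO.of_bound 1 ?_) (hgauss.add htail)
  filter_upwards [eventually_gt_atTop 0] with β hβ
  rw [Real.norm_of_nonneg (integral_nonneg fun _ => (Real.exp_pos _).le), one_mul]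
  refine le_trans ?_ (le_abs_self _)
  refine le_trans ?_ (integral_exp_neg_mul_sq_norm_sub_le hM hr.le hμ (mul_pos hβ hc))
  refine integral_mono_of_nonneg (Eventually.of_forall fun _ => (Real.exp_pos _).le) ?_ ?_
  · refine (integrable_const (1 : ℝ)).mono' (by fun_prop) (Eventually.of_forall fun x => ?_)
    rw [Real.norm_of_nonneg (Real.exp_pos _).le, Real.exp_le_one_iff]
    have : 0 ≤ β * c * ‖x - a‖ ^ 2 := by positivity
    linarith
  · filter_upwards [hφ] with x hx
    exact Real.exp_le_exp.2 (by nlinarith)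

end Gaussian

theorem measureReal_ball_mul_exp_le_integral_exp {E : Type*} [PseudoMetricSpace E]
    [MeasurableSpace E] [OpensMeasurableSpace E] {μ : Measure E} [IsFiniteMeasure μ] {φ : E → ℝ}
    {a : E} {β ρ C : ℝ} (hint : Integrable (fun x => Real.exp (-β * φ x)) μ)
    (hφ : ∀ x ∈ Metric.ball a ρ, β * φ x ≤ C) :
    μ.real (Metric.ball a ρ) * Real.exp (-C) ≤ ∫ x, Real.exp (-β * φ x) ∂μ := by
  calc μ.real (Metric.ball a ρ) * Real.exp (-C)
      = ∫ _ in Metric.ball a ρ, Real.exp (-C) ∂μ := by simp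
    _ ≤ ∫ x in Metric.ball a ρ, Real.exp (-β * φ x) ∂μ :=
      setIntegral_mono_on (integrable_const _) hint.integrableOn measurableSet_ball fun x hx =>
        Real.exp_le_exp.2 (by linarith [hφ x hx])
    _ ≤ ∫ x, Real.exp (-β * φ x) ∂μ :=
      setIntegral_le_integral hint (Eventually.of_forall fun _ => (Real.exp_pos _).le)

-- On the ball of radius `β^{-1/2}` about `a` the exponent `β φ` stays bounded.
theorem isBigO_integral_exp_neg_mul_rev {E : Type*} [NormedAddCommGroup E] [MeasurableSpace E]
    [OpensMeasurableSpace E] {μ : Measure E} [IsFiniteMeasure μ] {φ : E → ℝ} {a : E} {n : ℕ}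
    {m : ℝ} (hm : 0 < m) (hμ : ∀ᶠ ρ in 𝓝[>] 0, m * ρ ^ n ≤ μ.real (Metric.ball a ρ))
    (hφm : AEStronglyMeasurable φ μ) (hφ₀ : ∀ᵐ x ∂μ, 0 ≤ φ x)
    (hφ : (fun v => φ (a + v)) =O[𝓝 0] fun v => ‖v‖ ^ 2) :
    (fun β : ℝ => β ^ (-(n / 2 : ℝ))) =O[atTop] fun β => ∫ x, Real.exp (-β * φ x) ∂μ := by
  obtain ⟨C, hC, hbound⟩ := hφ.exists_pos
  obtain ⟨r, hr, hball⟩ := Metric.eventually_nhds_iff_ball.1 hbound.bound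
  have hscale : Tendsto (fun β : ℝ => β ^ (-(1 / 2) : ℝ)) atTop (𝓝[>] 0) :=
    tendsto_nhdsWithin_iff.2 ⟨tendsto_rpow_neg_atTop (by norm_num),
      (eventually_gt_atTop 0).mono fun β hβ => Real.rpow_pos_of_pos hβ _⟩
  refine IsBigO.of_bound (m * Real.exp (-C))⁻¹ ?_
  filter_upwards [hscale.eventually hμ, hscale.eventually (Ioo_mem_nhdsGT hr),
    eventually_gt_atTop 0] with β hmass hρ hβ
  set ρ := β ^ (-(1 / 2) : ℝ) with hρ_def
  have hρsq : β * ρ ^ 2 = 1 := by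
    rw [hρ_def, ← Real.rpow_natCast, ← Real.rpow_mul hβ.le]
    norm_num [Real.rpow_neg_one, mul_inv_cancel₀ hβ.ne']
  have hρpow : β ^ (-(n / 2 : ℝ)) = ρ ^ n := by
    rw [hρ_def, ← Real.rpow_natCast, ← Real.rpow_mul hβ.le]
    ring_nf
  have hint : Integrable (fun x => Real.exp (-β * φ x)) μ := by
    refine (integrable_const (1 : ℝ)).mono' (Real.continuous_exp.comp_aestronglyMeasurable
      (hφm.const_mul _)) (hφ₀.mono fun x hx => ?_)
    rw [Real.norm_of_nonneg (Real.exp_pos _).le, Real.exp_le_one_iff]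
    nlinarith
  have hball' : ∀ x ∈ Metric.ball a ρ, β * φ x ≤ C := fun x hx => by
    have hxρ : ‖x - a‖ < ρ := by simpa [dist_eq_norm] using hx
    have hsq := hball (x - a) (by simpa using hxρ.trans hρ.2)
    simp only [add_sub_cancel, norm_pow, norm_norm] at hsq
    calc β * φ x ≤ β * (C * ρ ^ 2) := by
          gcongr
          exact ((le_abs_self _).trans hsq).trans (by gcongr)
      _ = C := by rw [mul_left_comm, hρsq, mul_one]
  rw [Real.norm_of_nonneg (by positivity),
    Real.norm_of_nonneg (integral_nonneg fun _ => (Real.exp_pos _).le), hρpow,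
    le_inv_mul_iff₀ (by positivity), mul_right_comm]
  exact (mul_le_mul_of_nonneg_right hmass (Real.exp_pos _).le).trans
    (measureReal_ball_mul_exp_le_integral_exp hint hball')

end Laplace

section Density

theorem exists_restrict_ball_withDensity_le {E : Type*} [PseudoMetricSpace E] [MeasurableSpace E]
    [OpensMeasurableSpace E] (ν : Measure E) {f : E → ℝ} {a : E} (hf : ContinuousAt f a) :
    ∃ r > 0, (ν.withDensity fun x => ENNReal.ofReal (f x)).restrict (Metric.ball a r)
      ≤ ENNReal.ofReal (f a + 1) • ν := by
  obtain ⟨r, hr, h⟩ := Metric.eventually_nhds_iff_ball.1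
    (hf.eventually (gt_mem_nhds (lt_add_one (f a))))
  refine ⟨r, hr, ?_⟩
  have hle : ∀ᵐ x ∂ν.restrict (Metric.ball a r),
      ENNReal.ofReal (f x) ≤ ENNReal.ofReal (f a + 1) :=
    (ae_restrict_iff' measurableSet_ball).2 (Eventually.of_forall fun x hx =>
      ENNReal.ofReal_le_ofReal (h x hx).le)
  rw [restrict_withDensity measurableSet_ball]
  refine (withDensity_mono hle).trans ?_
  rw [withDensity_const]
  gcongr
  exact Measure.restrict_le_self

theorem eventually_mul_measure_ball_le_withDensity {E : Type*} [PseudoMetricSpace E]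
    [MeasurableSpace E] [OpensMeasurableSpace E] (ν : Measure E) {f : E → ℝ} {a : E}
    (hf : ContinuousAt f a) (ha : 0 < f a) :
    ∀ᶠ ρ in 𝓝[>] (0 : ℝ), ENNReal.ofReal (f a / 2) * ν (Metric.ball a ρ)
      ≤ ν.withDensity (fun x => ENNReal.ofReal (f x)) (Metric.ball a ρ) := by
  obtain ⟨r, hr, h⟩ := Metric.eventually_nhds_iff_ball.1
    (hf.eventually (lt_mem_nhds (half_lt_self ha)))
  filter_upwards [Ioo_mem_nhdsGT hr] with ρ hρ
  rw [withDensity_apply _ measurableSet_ball, ← setLIntegral_const]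
  exact setLIntegral_mono' measurableSet_ball fun x hx =>
    ENNReal.ofReal_le_ofReal (h x (Metric.ball_subset_ball hρ.2.le hx)).le

end Density

namespace ReferenceLaw

variable {d : ℕ} {L : Space d → ℝ} {Xstar : Space d} {Ω₀ : Type*} [MeasurableSpace Ω₀]
  {P₀ : Measure Ω₀} {Xin : Ω₀ → Space d} {f : Space d → ℝ}

theorem ae_mem_tsupport (h : ReferenceLaw P₀ Xin f Xstar) : ∀ᵐ ω ∂P₀, Xin ω ∈ tsupport f := by
  have hf := h.measurable_density
  refine ae_of_ae_map (p := (· ∈ tsupport f)) h.measurable_var.aemeasurable ?_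
  rw [h.law_eq, ae_withDensity_iff (by fun_prop)]
  refine Eventually.of_forall fun x hx => subset_tsupport f fun h₀ => hx ?_
  simp [h₀]

theorem exists_ae_norm_le (h : ReferenceLaw P₀ Xin f Xstar) : ∃ R, ∀ᵐ ω ∂P₀, ‖Xin ω‖ ≤ R := by
  obtain ⟨R, hR⟩ := h.compactSupport.isCompact.isBounded.exists_norm_le
  exact ⟨R, h.ae_mem_tsupport.mono fun ω hω => hR _ hω⟩

theorem exists_mul_pow_le_measureReal_ball [IsFiniteMeasure P₀]
    (h : ReferenceLaw P₀ Xin f Xstar) :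
    ∃ m > 0, ∀ᶠ ρ in 𝓝[>] 0, m * ρ ^ d ≤ (P₀.map Xin).real (Metric.ball Xstar ρ) := by
  have hpos := h.pos
  have hunit : 0 < volume.real (Metric.ball (0 : Space d) 1) :=
    ENNReal.toReal_pos (Metric.measure_ball_pos _ _ one_pos).ne' measure_ball_lt_top.ne
  refine ⟨f Xstar / 2 * volume.real (Metric.ball (0 : Space d) 1), by positivity, ?_⟩
  filter_upwards [eventually_mul_measure_ball_le_withDensity volume h.continuousAt hpos,
    self_mem_nhdsWithin] with ρ hρ hρ₀
  have hρ₀ : 0 < ρ := hρ₀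
  rw [← h.law_eq, Measure.addHaar_ball_of_pos _ _ hρ₀] at hρ
  have := ENNReal.toReal_mono (measure_ne_top _ _) hρ
  rw [ENNReal.toReal_mul, ENNReal.toReal_mul, ENNReal.toReal_ofReal (by positivity),
    ENNReal.toReal_ofReal (by positivity), finrank_euclideanSpace_fin] at this
  exact le_of_eq_of_le (by simp only [Measure.real]; ring) this

theorem isTheta_integral_exp [IsFiniteMeasure P₀] (h : ReferenceLaw P₀ Xin f Xstar)
    (hL : ContDiff ℝ 2 L) (hmin : ∀ x, x ≠ Xstar → L Xstar < L x)
    (hdet : (hessian L Xstar).det ≠ 0) :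
    (fun β => ∫ ω, Real.exp (-β * (L (Xin ω) - L Xstar)) ∂P₀)
      =Θ[atTop] fun β => β ^ (-(d / 2 : ℝ)) := by
  have hle := le_of_forall_ne_lt hmin
  have hlocmin : IsLocalMin L Xstar := Eventually.of_forall hle
  have hcont : Continuous L := hL.continuous
  have hexp : ∀ β : ℝ, Continuous fun x => Real.exp (-β * (L x - L Xstar)) := by fun_prop
  have hmap : ∀ β, ∫ ω, Real.exp (-β * (L (Xin ω) - L Xstar)) ∂P₀
      = ∫ x, Real.exp (-β * (L x - L Xstar)) ∂P₀.map Xin := fun β =>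
    (integral_map h.measurable_var.aemeasurable (hexp β).aestronglyMeasurable).symm
  simp only [hmap]
  constructor
  · obtain ⟨c, hc, hgrowth⟩ := exists_mul_sq_le_on_isCompact (φ := fun x => L x - L Xstar)
      h.compactSupport.isCompact (by fun_prop) (fun x hx => sub_pos.2 (hmin x hx))
      (exists_mul_sq_le_of_isLocalMin hL.contDiffAt hlocmin hdet)
    obtain ⟨r, hr, hdens⟩ := exists_restrict_ball_withDensity_le volume h.continuousAt
    rw [← h.law_eq] at hdens
    have hsupp : ∀ᵐ x ∂P₀.map Xin, x ∈ tsupport f :=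
      (ae_map_iff h.measurable_var.aemeasurable (isClosed_tsupport f).measurableSet).2
        h.ae_mem_tsupport
    simpa using isBigO_integral_exp_neg_mul hc hr ENNReal.ofReal_ne_top hdens
      (hsupp.mono fun x hx => hgrowth x hx)
  · obtain ⟨m, hm, hmass⟩ := h.exists_mul_pow_le_measureReal_ball
    exact isBigO_integral_exp_neg_mul_rev hm hmass (Continuous.aestronglyMeasurable (by fun_prop))
      (Eventually.of_forall fun x => sub_nonneg.2 (hle x))
      (isBigO_sq_of_fderiv_eq_zero hL.contDiffAt hlocmin.fderiv_eq_zero)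

end ReferenceLaw

section Configuration

variable {d N : ℕ} {L : Space d → ℝ} {β : ℝ}

/-- The spread `maxᵢ (yᵢ - ȳ)²` of the `l`-th coordinates of a configuration about their mean;
its expectation is the `l`-th summand of `initialSpread`. -/
def spread (y : Fin N → Space d) (l : Fin d) : ℝ := ⨆ i, (y i l - ensembleMean y l) ^ 2

/-- The average Gibbs weight `N⁻¹ ∑ᵢ e^{-β L(yᵢ)}` of a configuration. It is the Lyapunov function
of the scheme: its decrease in one step is controlled by the spread. -/
def meanWeight (β : ℝ) (L : Space d → ℝ) (y : Fin N → Space d) : ℝ :=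
  (N : ℝ)⁻¹ * ∑ i, Real.exp (-β * L (y i))

theorem le_spread (y : Fin N → Space d) (l : Fin d) (i : Fin N) :
    (y i l - ensembleMean y l) ^ 2 ≤ spread y l :=
  le_ciSup (f := fun i => (y i l - ensembleMean y l) ^ 2) (Set.finite_range _).bddAbove i

theorem spread_nonneg (y : Fin N → Space d) (l : Fin d) : 0 ≤ spread y l :=
  Real.iSup_nonneg fun _ => sq_nonneg _

theorem ensembleMean_apply (y : Fin N → Space d) (l : Fin d) :
    ensembleMean y l = (N : ℝ)⁻¹ * ∑ j, y j l := by
  simp [ensembleMean, WithLp.ofLp_sum, Finset.sum_apply]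

theorem sub_ensembleMean_apply (hN : 0 < N) (y : Fin N → Space d) (l : Fin d) (i : Fin N) :
    y i l - ensembleMean y l = (N : ℝ)⁻¹ * ∑ j, (y i l - y j l) := by
  have : (N : ℝ) ≠ 0 := by positivity
  simp only [ensembleMean_apply, Finset.sum_sub_distrib, Finset.sum_const, Finset.card_univ,
    Fintype.card_fin, nsmul_eq_mul]
  field_simp

theorem spread_eq_sq_mul (hN : 0 < N) {y y' : Fin N → Space d} {l : Fin d} {q : ℝ}
    (h : ∀ i j, y' i l - y' j l = q * (y i l - y j l)) : spread y' l = q ^ 2 * spread y l := by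
  rw [spread, spread, Real.mul_iSup_of_nonneg (sq_nonneg q)]
  congr with i
  simp only [sub_ensembleMean_apply hN, h, ← Finset.mul_sum]
  ring

theorem sum_exp_pos (hN : 0 < N) (y : Fin N → Space d) : 0 < ∑ j, Real.exp (-β * L (y j)) :=
  Finset.sum_pos (fun _ _ => Real.exp_pos _) ⟨⟨0, hN⟩, Finset.mem_univ _⟩

theorem weightedMean_apply (y : Fin N → Space d) (l : Fin d) :
    weightedMean β L y l =
      ∑ j, ((∑ k, Real.exp (-β * L (y k)))⁻¹ * Real.exp (-β * L (y j))) * y j l := by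
  simp [weightedMean, WithLp.ofLp_sum, Finset.sum_apply, Finset.mul_sum, mul_assoc]

theorem sum_exp_mul_sub_weightedMean (hN : 0 < N) (y : Fin N → Space d) (l : Fin d) :
    ∑ i, Real.exp (-β * L (y i)) * (y i l - weightedMean β L y l) = 0 := by
  have hW := (sum_exp_pos (L := L) (β := β) hN y).ne'
  simp only [mul_sub, Finset.sum_sub_distrib, ← Finset.sum_mul]
  simp only [weightedMean_apply, mul_assoc, ← Finset.mul_sum, mul_inv_cancel_left₀ hW, sub_self]

theorem sum_sq_sub_average_le {ι : Type*} [Fintype ι] {y p : ι → ℝ} {M : ℝ}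
    (hy : ∑ i, y i = 0) (hp : ∀ i, 0 ≤ p i) (hp1 : ∑ i, p i = 1) (hM : ∀ i, y i ^ 2 ≤ M) :
    ∑ i, (y i - ∑ j, p j * y j) ^ 2 ≤ 2 * Fintype.card ι * M := by
  set w := ∑ j, p j * y j
  have hw : w ^ 2 ≤ M :=
    calc w ^ 2 ≤ ∑ j, p j * y j ^ 2 :=
          Real.pow_arith_mean_le_arith_mean_pow_of_even _ p y (fun i _ => hp i) hp1 even_two
      _ ≤ ∑ j, p j * M :=
          Finset.sum_le_sum fun j _ => mul_le_mul_of_nonneg_left (hM j) (hp j)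
      _ = M := by rw [← Finset.sum_mul, hp1, one_mul]
  calc ∑ i, (y i - w) ^ 2 = ∑ i, (y i ^ 2 - 2 * w * y i + w ^ 2) :=
        Finset.sum_congr rfl fun i _ => by ring
    _ = ∑ i, y i ^ 2 + Fintype.card ι * w ^ 2 := by
        simp [Finset.sum_add_distrib, Finset.sum_sub_distrib, ← Finset.mul_sum, hy]
    _ ≤ ∑ _i : ι, M + Fintype.card ι * M := by
        gcongr with i
        exact hM i
    _ = 2 * Fintype.card ι * M := by simp; ring

theorem sum_sq_sub_weightedMean_le (hN : 0 < N) (y : Fin N → Space d) (l : Fin d) :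
    ∑ i, (y i l - weightedMean β L y l) ^ 2 ≤ 2 * N * spread y l := by
  set p : Fin N → ℝ := fun j => (∑ k, Real.exp (-β * L (y k)))⁻¹ * Real.exp (-β * L (y j))
  have hW := sum_exp_pos (L := L) (β := β) hN y
  have hp1 : ∑ j, p j = 1 := by rw [← Finset.mul_sum, inv_mul_cancel₀ hW.ne']
  have hcentred : ∑ i, (y i l - ensembleMean y l) = 0 := by
    have : (N : ℝ) ≠ 0 := by positivity
    simp [ensembleMean_apply, this]
  have hdev : ∀ i, y i l - weightedMean β L y l = (y i l - ensembleMean y l)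
      - ∑ j, p j * (y j l - ensembleMean y l) := fun i => by
    simp only [mul_sub, Finset.sum_sub_distrib, ← Finset.sum_mul, hp1, weightedMean_apply, p]
    ring
  simpa [hdev] using sum_sq_sub_average_le hcentred (fun j => by positivity) hp1
    fun i => le_spread y l i

end Configuration

section Step

variable {d N : ℕ} {L : Space d → ℝ} {β γ s : ℝ} {ξ : Fin d → ℝ} {y : Fin N → Space d}

/-- One step of the scheme from the configuration `y`, with noise vector `ξ`. -/
def step (β : ℝ) (L : Space d → ℝ) (γ : ℝ) (ξ : Fin d → ℝ) (y : Fin N → Space d) :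
    Fin N → Space d := fun i =>
  y i - γ • (y i - weightedMean β L y)
    - ∑ l, ((y i l - weightedMean β L y l) * ξ l) • (EuclideanSpace.single l 1 : Space d)

/-- The coefficient with which a squared deviation enters the one-step estimate when the noise
takes the value `t`; the parameter `s > 0` is the weight in Young's inequality. -/
def stepCost (γ s t : ℝ) : ℝ := s / 2 * (1 + (1 - γ - t) ^ 2) + (γ + t) ^ 2 / (2 * s)

/-- The bound for the one-step variation from the configuration `y` under the noise `ξ`, up to
constants depending only on the objective. -/
def stepBound (γ s : ℝ) (ξ : Fin d → ℝ) (y : Fin N → Space d) : ℝ :=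
  ∑ l, stepCost γ s (ξ l) * spread y l

theorem half_le_stepCost (hs : 0 < s) (t : ℝ) : s / 2 ≤ stepCost γ s t := by
  have : 0 ≤ s / 2 * (1 - γ - t) ^ 2 + (γ + t) ^ 2 / (2 * s) := by positivity
  unfold stepCost
  linarith

theorem stepCost_nonneg (hs : 0 < s) (t : ℝ) : 0 ≤ stepCost γ s t :=
  (half_pos hs).le.trans (half_le_stepCost hs t)

theorem stepBound_nonneg (hs : 0 < s) (ξ : Fin d → ℝ) (y : Fin N → Space d) :
    0 ≤ stepBound γ s ξ y :=
  Finset.sum_nonneg fun _ _ => mul_nonneg (stepCost_nonneg hs _) (spread_nonneg _ _)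

theorem step_apply (i : Fin N) (l : Fin d) :
    step β L γ ξ y i l = y i l - (γ + ξ l) * (y i l - weightedMean β L y l) := by
  have hnoise : (∑ k, ((y i k - weightedMean β L y k) * ξ k) •
      (EuclideanSpace.single k 1 : Space d)) l = (y i l - weightedMean β L y l) * ξ l := by
    simp [WithLp.ofLp_sum, Finset.sum_apply, Pi.single_apply]
  rw [step, PiLp.sub_apply, hnoise, PiLp.sub_apply, PiLp.smul_apply, PiLp.sub_apply, smul_eq_mul]
  ring

theorem spread_step (hN : 0 < N) (l : Fin d) :
    spread (step β L γ ξ y) l = (1 - γ - ξ l) ^ 2 * spread y l :=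
  spread_eq_sq_mul hN fun i j => by
    rw [step_apply, step_apply]
    ring

theorem sum_exp_mul_map_step_sub (hN : 0 < N) (φ : Space d →L[ℝ] ℝ) :
    ∑ i, Real.exp (-β * L (y i)) * φ (step β L γ ξ y i - y i) = 0 := by
  have hzero : ∑ i, Real.exp (-β * L (y i)) • (step β L γ ξ y i - y i) = 0 := by
    ext l
    simp only [WithLp.ofLp_sum, Finset.sum_apply, PiLp.smul_apply, PiLp.sub_apply, smul_eq_mul,
      PiLp.zero_apply, step_apply]
    calc _ = -(γ + ξ l) * ∑ i, Real.exp (-β * L (y i)) * (y i l - weightedMean β L y l) := by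
          rw [Finset.mul_sum]
          exact Finset.sum_congr rfl fun i _ => by ring
      _ = 0 := by rw [sum_exp_mul_sub_weightedMean hN, mul_zero]
  simpa [map_sum] using congrArg φ hzero

theorem sum_stepCost_mul_sq (i : Fin N) :
    ∑ l, stepCost γ s (ξ l) * (y i l - weightedMean β L y l) ^ 2
      = s / 2 * (‖y i - weightedMean β L y‖ ^ 2 + ‖step β L γ ξ y i - weightedMean β L y‖ ^ 2)
        + ‖step β L γ ξ y i - y i‖ ^ 2 / (2 * s) := by
  simp only [EuclideanSpace.real_norm_sq_eq, PiLp.sub_apply, step_apply]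
  rw [← Finset.sum_add_distrib, Finset.mul_sum, Finset.sum_div, ← Finset.sum_add_distrib]
  refine Finset.sum_congr rfl fun l _ => ?_
  unfold stepCost
  ring

theorem sum_sum_stepCost_mul_sq_le (hN : 0 < N) (hs : 0 < s) :
    ∑ i, ∑ l, stepCost γ s (ξ l) * (y i l - weightedMean β L y l) ^ 2
      ≤ 2 * N * stepBound γ s ξ y := by
  rw [Finset.sum_comm, stepBound, Finset.mul_sum]
  refine Finset.sum_le_sum fun l _ => ?_
  rw [← Finset.mul_sum, mul_left_comm]
  exact mul_le_mul_of_nonneg_left (sum_sq_sub_weightedMean_le hN y l) (stepCost_nonneg hs _)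

theorem sum_stepCost_mul_sq_le (hN : 0 < N) (hs : 0 < s) (i : Fin N) :
    ∑ l, stepCost γ s (ξ l) * (y i l - weightedMean β L y l) ^ 2 ≤ 2 * N * stepBound γ s ξ y :=
  (Finset.single_le_sum
    (f := fun i => ∑ l, stepCost γ s (ξ l) * (y i l - weightedMean β L y l) ^ 2)
    (fun _ _ => Finset.sum_nonneg fun _ _ => mul_nonneg (stepCost_nonneg hs _) (sq_nonneg _))
    (Finset.mem_univ i)).trans (sum_sum_stepCost_mul_sq_le hN hs)

theorem norm_step_sub_le (hN : 0 < N) (hs : 0 < s) (i : Fin N) :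
    ‖step β L γ ξ y i - y i‖ ≤ √(4 * N * s) * √(stepBound γ s ξ y) := by
  rw [← Real.sqrt_mul (by positivity)]
  refine Real.le_sqrt_of_sq_le ?_
  have hcost := sum_stepCost_mul_sq_le (β := β) (L := L) (γ := γ) (ξ := ξ) (y := y) hN hs i
  rw [sum_stepCost_mul_sq] at hcost
  have hnonneg : 0 ≤ s / 2 * (‖y i - weightedMean β L y‖ ^ 2
      + ‖step β L γ ξ y i - weightedMean β L y‖ ^ 2) := by positivity
  have : ‖step β L γ ξ y i - y i‖ ^ 2 / (2 * s) ≤ 2 * N * stepBound γ s ξ y := by linarith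
  rw [div_le_iff₀ (by positivity)] at this
  linarith

theorem norm_sub_weightedMean_le (hN : 0 < N) (hs : 0 < s) (i : Fin N) :
    ‖y i - weightedMean β L y‖ ≤ √(4 * N / s) * √(stepBound γ s ξ y) := by
  rw [← Real.sqrt_mul (by positivity)]
  refine Real.le_sqrt_of_sq_le ?_
  have hcost : s / 2 * ‖y i - weightedMean β L y‖ ^ 2 ≤ 2 * N * stepBound γ s ξ y := by
    refine le_trans ?_ (sum_stepCost_mul_sq_le (β := β) (L := L) hN hs i)
    rw [EuclideanSpace.real_norm_sq_eq, Finset.mul_sum]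
    exact Finset.sum_le_sum fun l _ =>
      mul_le_mul_of_nonneg_right (half_le_stepCost hs _) (sq_nonneg _)
  calc ‖y i - weightedMean β L y‖ ^ 2
      = 2 / s * (s / 2 * ‖y i - weightedMean β L y‖ ^ 2) := by field_simp
    _ ≤ 2 / s * (2 * N * stepBound γ s ξ y) := by gcongr
    _ = 4 * N / s * stepBound γ s ξ y := by ring

theorem exp_sub_exp_le (a b : ℝ) :
    Real.exp (-β * a) - Real.exp (-β * b) ≤ β * (Real.exp (-β * a) * (b - a)) := by
  have hfactor : Real.exp (-β * b) = Real.exp (-β * a) * Real.exp (-β * (b - a)) := by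
    rw [← Real.exp_add]
    ring_nf
  rw [hfactor]
  nlinarith [Real.exp_pos (-β * a), Real.add_one_le_exp (-β * (b - a))]

theorem exp_sub_exp_step_le {K : NNReal} {m : ℝ} (hL : Differentiable ℝ L)
    (hLip : LipschitzWith K (fderiv ℝ L)) (hm : ∀ x, m ≤ L x) (hβ : 0 ≤ β) (hs : 0 < s)
    (i : Fin N) :
    Real.exp (-β * L (y i)) - Real.exp (-β * L (step β L γ ξ y i))
      ≤ β * (Real.exp (-β * L (y i)) *
          fderiv ℝ L (weightedMean β L y) (step β L γ ξ y i - y i))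
        + β * (K * Real.exp (-β * m) *
          ∑ l, stepCost γ s (ξ l) * (y i l - weightedMean β L y l) ^ 2) := by
  set Q := ∑ l, stepCost γ s (ξ l) * (y i l - weightedMean β L y l) ^ 2 with hQ
  have hQ₀ : 0 ≤ Q :=
    Finset.sum_nonneg fun _ _ => mul_nonneg (stepCost_nonneg hs _) (sq_nonneg _)
  have hincrement : L (step β L γ ξ y i) - L (y i)
      ≤ fderiv ℝ L (weightedMean β L y) (step β L γ ξ y i - y i) + K * Q := by
    rw [hQ, sum_stepCost_mul_sq]
    exact sub_le_of_lipschitzWith_fderiv hL hLip _ _ _ hs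
  have hweight : Real.exp (-β * L (y i)) ≤ Real.exp (-β * m) :=
    Real.exp_le_exp.2 (by nlinarith [hm (y i)])
  refine (exp_sub_exp_le _ _).trans ?_
  rw [← mul_add]
  gcongr
  calc _ ≤ Real.exp (-β * L (y i)) *
        (fderiv ℝ L (weightedMean β L y) (step β L γ ξ y i - y i) + K * Q) := by gcongr
    _ = _ + Real.exp (-β * L (y i)) * (K * Q) := mul_add _ _ _
    _ ≤ _ + Real.exp (-β * m) * (K * Q) := by gcongr
    _ = _ := by ring

-- The first-order terms cancel because the Gibbs weights balance the deviations from the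
-- weighted mean, at which the derivative is frozen.
theorem meanWeight_sub_meanWeight_step_le {K : NNReal} {m : ℝ} (hL : Differentiable ℝ L)
    (hLip : LipschitzWith K (fderiv ℝ L)) (hm : ∀ x, m ≤ L x) (hβ : 0 ≤ β) (hN : 0 < N)
    (hs : 0 < s) :
    meanWeight β L y - meanWeight β L (step β L γ ξ y)
      ≤ 2 * β * K * Real.exp (-β * m) * stepBound γ s ξ y := by
  have hsum := Finset.sum_le_sum fun i (_ : i ∈ Finset.univ) =>
    exp_sub_exp_step_le (γ := γ) (ξ := ξ) (y := y) hL hLip hm hβ hs i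
  rw [Finset.sum_add_distrib, ← Finset.mul_sum, sum_exp_mul_map_step_sub hN, mul_zero, zero_add,
    ← Finset.mul_sum, ← Finset.mul_sum, Finset.sum_sub_distrib] at hsum
  rw [meanWeight, meanWeight, ← mul_sub, inv_mul_le_iff₀ (by positivity)]
  calc _ ≤ _ := hsum
    _ ≤ β * (K * Real.exp (-β * m) * (2 * N * stepBound γ s ξ y)) := by
        gcongr
        exact sum_sum_stepCost_mul_sq_le hN hs
    _ = _ := by ring

end Step

section Trajectory

variable {d N : ℕ} {L : Space d → ℝ} {β γ s : ℝ} {η : ℕ → Fin d → ℝ} {x : ℕ → Fin N → Space d}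

/-- A deterministic trajectory of the scheme driven by the noise sequence `η`. -/
def IsTrajectory (L : Space d → ℝ) (β γ : ℝ) (η : ℕ → Fin d → ℝ) (x : ℕ → Fin N → Space d) :
    Prop :=
  ∀ n, x (n + 1) = step β L γ (η n) (x n)

/-- The factor by which `n` steps of the scheme scale the differences between particles in one
coordinate, when the noise in that coordinate is `ξ`. -/
def contraction (γ : ℝ) (ξ : ℕ → ℝ) (n : ℕ) : ℝ := ∏ k ∈ Finset.range n, (1 - γ - ξ k)

theorem contraction_sq_succ (ξ : ℕ → ℝ) (n : ℕ) :
    contraction γ ξ (n + 1) ^ 2 = contraction γ ξ n ^ 2 * (1 - γ - ξ n) ^ 2 := by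
  rw [contraction, Finset.prod_range_succ, mul_pow, contraction]

theorem IsTrajectory.spread_eq (h : IsTrajectory L β γ η x) (hN : 0 < N) (n : ℕ) (l : Fin d) :
    spread (x n) l = contraction γ (fun k => η k l) n ^ 2 * spread (x 0) l := by
  induction n with
  | zero => simp [contraction]
  | succ n ih =>
    rw [h n, spread_step hN, ih, contraction_sq_succ]
    ring

theorem IsTrajectory.exists_tendsto (h : IsTrajectory L β γ η x) (hN : 0 < N) (hs : 0 < s)
    (hsum : Summable fun n => √(stepBound γ s (η n) (x n))) :
    ∃ z, ∀ i, Tendsto (fun n => x n i) atTop (𝓝 z) := by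
  have hconv : ∀ i, ∃ z, Tendsto (fun n => x n i) atTop (𝓝 z) := fun i => by
    refine cauchySeq_tendsto_of_complete (cauchySeq_of_summable_dist ?_)
    refine (hsum.mul_left √(4 * N * s)).of_nonneg_of_le (fun _ => dist_nonneg) fun n => ?_
    rw [dist_comm, dist_eq_norm, Nat.succ_eq_add_one, h n]
    exact norm_step_sub_le hN hs i
  choose z hz using hconv
  have hdev : ∀ i, Tendsto (fun n => x n i - weightedMean β L (x n)) atTop (𝓝 0) := fun i =>
    squeeze_zero_norm (fun n => norm_sub_weightedMean_le (ξ := η n) hN hs i)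
      (by simpa using hsum.tendsto_atTop_zero.const_mul √(4 * N / s))
  refine ⟨z ⟨0, hN⟩, fun i => ?_⟩
  have hdiff : Tendsto (fun n => x n i - x n ⟨0, hN⟩) atTop (𝓝 0) := by
    simpa using (hdev i).sub (hdev ⟨0, hN⟩)
  have hzz : z i - z ⟨0, hN⟩ = 0 := tendsto_nhds_unique ((hz i).sub (hz _)) hdiff
  exact sub_eq_zero.1 hzz ▸ hz i

end Trajectory

section Sequences

theorem ae_summable_sqrt {Ω : Type*} [MeasurableSpace Ω] {P : Measure Ω} {b : ℕ → Ω → ℝ}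
    (hb : ∀ n ω, 0 ≤ b n ω) (hint : ∀ n, Integrable (b n) P)
    (hsum : Summable fun n => √(∫ ω, b n ω ∂P)) : ∀ᵐ ω ∂P, Summable fun n => √(b n ω) := by
  have hmeas : ∀ n, AEStronglyMeasurable (fun ω => √(b n ω)) P := fun n =>
    Real.continuous_sqrt.comp_aestronglyMeasurable (hint n).aestronglyMeasurable
  have hnorm : ∀ n, eLpNorm (fun ω => √(b n ω)) 2 P = ENNReal.ofReal √(∫ ω, b n ω ∂P) := fun n => by
    have hsq : ∀ ω, √(b n ω) ^ 2 = b n ω := fun ω => Real.sq_sqrt (hb n ω)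
    have hLp : MemLp (fun ω => √(b n ω)) 2 P :=
      (memLp_two_iff_integrable_sq (hmeas n)).2 (by simpa only [hsq] using hint n)
    rw [hLp.eLpNorm_eq_integral_rpow_norm two_ne_zero ENNReal.ofNat_ne_top]
    simp only [ENNReal.toReal_ofNat, Real.rpow_ofNat, Real.norm_of_nonneg (Real.sqrt_nonneg _), hsq]
    rw [Real.sqrt_eq_rpow, one_div]
  simpa only [Real.norm_of_nonneg (Real.sqrt_nonneg _)] using
    summable_norm_of_tsum_eLpNorm_ne_top one_le_two hmeas
      (by simpa only [hnorm] using hsum.tsum_ofReal_ne_top)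

theorem summable_sqrt_geometric_mul {ρ : ℝ} (hρ₀ : 0 ≤ ρ) (hρ₁ : ρ < 1) (C : ℝ) :
    Summable fun n : ℕ => √(ρ ^ n * C) := by
  have hsqrt : ∀ n : ℕ, √(ρ ^ n * C) = √ρ ^ n * √C := fun n => by
    have hsq : (√ρ ^ n) ^ 2 = ρ ^ n := by rw [pow_right_comm, Real.sq_sqrt hρ₀]
    rw [← hsq, Real.sqrt_mul (sq_nonneg _), Real.sqrt_sq (by positivity)]
  simp only [hsqrt]
  exact (summable_geometric_of_lt_one (Real.sqrt_nonneg ρ)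
    (Real.sqrt_one ▸ Real.sqrt_lt_sqrt hρ₀ hρ₁)).mul_right _

theorem sub_div_one_sub_le_of_tendsto {a : ℕ → ℝ} {A ρ ℓ : ℝ} (hA : 0 ≤ A) (hρ₀ : 0 ≤ ρ)
    (hρ₁ : ρ < 1) (hstep : ∀ n, a n - a (n + 1) ≤ ρ ^ n * A) (hlim : Tendsto a atTop (𝓝 ℓ)) :
    a 0 - A / (1 - ρ) ≤ ℓ := by
  refine ge_of_tendsto' hlim fun n => ?_
  have htelescope : a 0 - a n ≤ (∑ k ∈ Finset.range n, ρ ^ k) * A := by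
    rw [← Finset.sum_range_sub', Finset.sum_mul]
    exact Finset.sum_le_sum fun k _ => hstep k
  have hgeom : (∑ k ∈ Finset.range n, ρ ^ k) * A ≤ (1 - ρ)⁻¹ * A := by
    gcongr
    rw [← tsum_geometric_of_lt_one hρ₀ hρ₁]
    exact (summable_geometric_of_lt_one hρ₀ hρ₁).sum_le_tsum _ fun k _ => pow_nonneg hρ₀ k
  rw [div_eq_inv_mul]
  linarith

theorem exists_half_mul_add_div_eq_sqrt_mul {a b : ℝ} (ha : 0 < a) (hb : 0 < b) :
    ∃ s > 0, s / 2 * a + b / (2 * s) = √(a * b) := by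
  refine ⟨√b / √a, by positivity, ?_⟩
  have : 0 < √a := Real.sqrt_pos.2 ha
  have : 0 < √b := Real.sqrt_pos.2 hb
  rw [Real.sqrt_mul ha.le]
  nth_rewrite 2 [← Real.sq_sqrt ha.le]
  nth_rewrite 2 [← Real.sq_sqrt hb.le]
  field_simp
  ring

end Sequences

section Noise

variable {Ω : Type*} [MeasurableSpace Ω] {P : Measure Ω} {γ ζ s : ℝ} {ξ : ℕ → Ω → ℝ}

/-- The variables `ξ n` are independent, square integrable, centred, with variance `ζ²`; unlike for
`Noise`, their laws may differ. -/
structure WhiteNoise (P : Measure Ω) (ζ : ℝ) (ξ : ℕ → Ω → ℝ) : Prop where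
  indep : iIndepFun ξ P
  memLp : ∀ n, MemLp (ξ n) 2 P
  mean : ∀ n, ∫ ω, ξ n ω ∂P = 0
  variance : ∀ n, ∫ ω, ξ n ω ^ 2 ∂P = ζ ^ 2

theorem Noise.whiteNoise {d : ℕ} {η : ℕ → Fin d → Ω → ℝ} (h : Noise P ζ η) (l : Fin d) :
    WhiteNoise P ζ fun n => η n l where
  indep := h.indep.precomp (g := fun n => (n, l)) fun _ _ hmn => (Prod.ext_iff.1 hmn).1
  memLp n := h.memLp n l
  mean n := h.mean n l
  variance n := h.variance n l

/-- The mean of `stepCost γ s` under a centred noise of variance `ζ²`. -/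
def meanStepCost (γ ζ s : ℝ) : ℝ :=
  s / 2 * (1 + ((1 - γ) ^ 2 + ζ ^ 2)) + (γ ^ 2 + ζ ^ 2) / (2 * s)

theorem meanStepCost_nonneg (hs : 0 ≤ s) : 0 ≤ meanStepCost γ ζ s := by
  unfold meanStepCost
  positivity

theorem measurable_stepCost : Measurable (stepCost γ s) := by
  unfold stepCost
  fun_prop

namespace WhiteNoise

theorem indepFun_contraction (h : WhiteNoise P ζ ξ) (n : ℕ) :
    IndepFun (fun ω => contraction γ (fun k => ξ k ω) n) (ξ n) P := by
  have hfactors : iIndepFun (fun k ω => 1 - γ - ξ k ω) P :=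
    h.indep.comp (fun _ t => 1 - γ - t) fun _ => by fun_prop
  have hpast := hfactors.indepFun_prod_range_succ₀
    (fun k => (h.memLp k).aestronglyMeasurable.aemeasurable.const_sub _) n
  convert hpast.comp measurable_id (measurable_id.const_sub (1 - γ)) using 1
  · ext ω
    simp [contraction]
  · ext ω
    simp

theorem indepFun_contraction_sq (h : WhiteNoise P ζ ξ) (n : ℕ) {φ : ℝ → ℝ} (hφ : Measurable φ) :
    IndepFun (fun ω => contraction γ (fun k => ξ k ω) n ^ 2) (fun ω => φ (ξ n ω)) P :=
  (h.indepFun_contraction n).comp (measurable_id.pow_const 2) hφ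

variable [IsProbabilityMeasure P]

theorem integrable_sq_affine (h : WhiteNoise P ζ ξ) (a b : ℝ) (n : ℕ) :
    Integrable (fun ω => (a + b * ξ n ω) ^ 2) P :=
  ((memLp_const a).add ((h.memLp n).const_mul b)).integrable_sq

theorem integral_sq_affine (h : WhiteNoise P ζ ξ) (a b : ℝ) (n : ℕ) :
    ∫ ω, (a + b * ξ n ω) ^ 2 ∂P = a ^ 2 + b ^ 2 * ζ ^ 2 := by
  have hlin : Integrable (fun ω => 2 * a * b * ξ n ω) P :=
    ((h.memLp n).integrable one_le_two).const_mul _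
  have haffine : Integrable (fun ω => a ^ 2 + 2 * a * b * ξ n ω) P := (integrable_const _).add hlin
  have hquad : Integrable (fun ω => b ^ 2 * ξ n ω ^ 2) P := (h.memLp n).integrable_sq.const_mul _
  calc ∫ ω, (a + b * ξ n ω) ^ 2 ∂P
      = ∫ ω, (a ^ 2 + 2 * a * b * ξ n ω + b ^ 2 * ξ n ω ^ 2) ∂P := by
        congr with ω
        ring
    _ = a ^ 2 + b ^ 2 * ζ ^ 2 := by
        rw [integral_add haffine hquad, integral_add (integrable_const _) hlin,
          integral_const_mul, integral_const_mul, h.mean, h.variance]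
        simp

theorem integrable_sq_factor (h : WhiteNoise P ζ ξ) (n : ℕ) :
    Integrable (fun ω => (1 - γ - ξ n ω) ^ 2) P := by
  simpa [sub_eq_add_neg] using h.integrable_sq_affine (1 - γ) (-1) n

theorem integral_sq_factor (h : WhiteNoise P ζ ξ) (n : ℕ) :
    ∫ ω, (1 - γ - ξ n ω) ^ 2 ∂P = (1 - γ) ^ 2 + ζ ^ 2 := by
  simpa [sub_eq_add_neg] using h.integral_sq_affine (1 - γ) (-1) n

theorem integrable_sq_drift (h : WhiteNoise P ζ ξ) (n : ℕ) :
    Integrable (fun ω => (γ + ξ n ω) ^ 2) P := by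
  simpa using h.integrable_sq_affine γ 1 n

theorem integrable_stepCost (h : WhiteNoise P ζ ξ) (n : ℕ) :
    Integrable (fun ω => stepCost γ s (ξ n ω)) P :=
  (((integrable_const 1).add (h.integrable_sq_factor n)).const_mul _).add
    ((h.integrable_sq_drift n).div_const _)

theorem integral_stepCost (h : WhiteNoise P ζ ξ) (n : ℕ) :
    ∫ ω, stepCost γ s (ξ n ω) ∂P = meanStepCost γ ζ s := by
  have hfactor := h.integrable_sq_factor (γ := γ) n
  have hdrift : ∫ ω, (γ + ξ n ω) ^ 2 ∂P = γ ^ 2 + ζ ^ 2 := by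
    simpa using h.integral_sq_affine γ 1 n
  have hone : Integrable (fun ω => 1 + (1 - γ - ξ n ω) ^ 2) P := (integrable_const _).add hfactor
  unfold stepCost meanStepCost
  rw [integral_add (hone.const_mul _) ((h.integrable_sq_drift n).div_const _),
    integral_const_mul, integral_div, integral_add (integrable_const _) hfactor,
    h.integral_sq_factor, hdrift]
  simp

theorem integrable_contraction_sq (h : WhiteNoise P ζ ξ) (n : ℕ) :
    Integrable (fun ω => contraction γ (fun k => ξ k ω) n ^ 2) P := by
  induction n with
  | zero => simp [contraction]
  | succ n ih =>
    simp only [contraction_sq_succ]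
    exact (h.indepFun_contraction_sq n (φ := fun t => (1 - γ - t) ^ 2) (by fun_prop)).integrable_mul
      ih (h.integrable_sq_factor n)

theorem integral_contraction_sq (h : WhiteNoise P ζ ξ) (n : ℕ) :
    ∫ ω, contraction γ (fun k => ξ k ω) n ^ 2 ∂P = ((1 - γ) ^ 2 + ζ ^ 2) ^ n := by
  induction n with
  | zero => simp [contraction]
  | succ n ih =>
    simp only [contraction_sq_succ]
    have hind := h.indepFun_contraction_sq (γ := γ) n (φ := fun t => (1 - γ - t) ^ 2) (by fun_prop)
    rw [hind.integral_fun_mul_eq_mul_integral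
      (h.integrable_contraction_sq n).aestronglyMeasurable
      (h.integrable_sq_factor n).aestronglyMeasurable, ih, h.integral_sq_factor, ← pow_succ]

theorem integrable_contraction_sq_mul_stepCost (h : WhiteNoise P ζ ξ) (n : ℕ) :
    Integrable (fun ω => contraction γ (fun k => ξ k ω) n ^ 2 * stepCost γ s (ξ n ω)) P :=
  (h.indepFun_contraction_sq n measurable_stepCost).integrable_mul
    (h.integrable_contraction_sq n) (h.integrable_stepCost n)

theorem integral_contraction_sq_mul_stepCost (h : WhiteNoise P ζ ξ) (n : ℕ) :
    ∫ ω, contraction γ (fun k => ξ k ω) n ^ 2 * stepCost γ s (ξ n ω) ∂P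
      = ((1 - γ) ^ 2 + ζ ^ 2) ^ n * meanStepCost γ ζ s := by
  rw [(h.indepFun_contraction_sq n measurable_stepCost).integral_fun_mul_eq_mul_integral
    (h.integrable_contraction_sq n).aestronglyMeasurable
    (h.integrable_stepCost n).aestronglyMeasurable, h.integral_contraction_sq, h.integral_stepCost]

end WhiteNoise

end Noise

section FreeEnergy

variable {Ω : Type*} [MeasurableSpace Ω] {P : Measure Ω} {g : Ω → ℝ} {β m : ℝ}

theorem integrable_exp_neg_mul_of_le [IsFiniteMeasure P] (hβ : 0 ≤ β) (hg : AEMeasurable g P)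
    (hm : ∀ ω, m ≤ g ω) : Integrable (fun ω => Real.exp (-β * g ω)) P := by
  refine Integrable.of_bound (C := Real.exp (-β * m)) (by fun_prop)
    (Eventually.of_forall fun ω => ?_)
  rw [Real.norm_of_nonneg (Real.exp_pos _).le, Real.exp_le_exp]
  nlinarith [hm ω]

theorem le_freeEnergy_of_ae_le [IsProbabilityMeasure P] (hβ : 0 < β)
    (hpos : 0 < ∫ ω, Real.exp (-β * g ω) ∂P) (hm : ∀ᵐ ω ∂P, m ≤ g ω) :
    m ≤ freeEnergy P g β := by
  have hle : ∫ ω, Real.exp (-β * g ω) ∂P ≤ Real.exp (-β * m) := by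
    calc ∫ ω, Real.exp (-β * g ω) ∂P ≤ ∫ _ω, Real.exp (-β * m) ∂P := by
          refine integral_mono_of_nonneg (Eventually.of_forall fun ω => (Real.exp_pos _).le)
            (integrable_const _) (hm.mono fun ω hω => Real.exp_le_exp.2 ?_)
          nlinarith
      _ = Real.exp (-β * m) := by simp
  calc m = -(1 / β) * (-β * m) := by field_simp
    _ ≤ freeEnergy P g β :=
        mul_le_mul_of_nonpos_left ((Real.log_le_iff_le_exp hpos).2 hle) (by simpa using hβ.le)

theorem essInf_mem_Icc_freeEnergy [IsProbabilityMeasure P] (hβ : 0 < β)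
    (hpos : 0 < ∫ ω, Real.exp (-β * g ω) ∂P) (hm : ∀ᵐ ω ∂P, m ≤ g ω) :
    essInf g P ∈ Set.Icc m (freeEnergy P g β) :=
  ⟨le_essInf_of_ae_le m hm ⟨_, fun _ => le_freeEnergy_of_ae_le hβ hpos⟩,
    le_freeEnergy_of_ae_le hβ hpos (ae_essInf_le (isBoundedUnder_of_eventually_ge hm))⟩

theorem freeEnergy_le_sub_log {Ω₀ : Type*} [MeasurableSpace Ω₀] {P₀ : Measure Ω₀} {g₀ : Ω₀ → ℝ}
    {ε : ℝ} (hβ : 0 ≤ β) (hε : 0 < ε) (hpos : 0 < ∫ ω, Real.exp (-β * g₀ ω) ∂P₀)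
    (h : ε * ∫ ω, Real.exp (-β * g₀ ω) ∂P₀ ≤ ∫ ω, Real.exp (-β * g ω) ∂P) :
    freeEnergy P g β ≤ freeEnergy P₀ g₀ β - 1 / β * Real.log ε := by
  calc freeEnergy P g β
      ≤ -(1 / β) * Real.log (ε * ∫ ω, Real.exp (-β * g₀ ω) ∂P₀) :=
        mul_le_mul_of_nonpos_left (Real.log_le_log (mul_pos hε hpos) h) (by simpa using hβ)
    _ = freeEnergy P₀ g₀ β - 1 / β * Real.log ε := by
        rw [Real.log_mul hε.ne' hpos.ne', freeEnergy]
        ring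

end FreeEnergy

section Measurability

variable {d N : ℕ} {Ω : Type*} [MeasurableSpace Ω] {P : Measure Ω} {L : Space d → ℝ} {β γ : ℝ}
  {η : ℕ → Fin d → Ω → ℝ} {X : ℕ → Fin N → Ω → Space d}

theorem measurable_spread (l : Fin d) : Measurable fun y : Fin N → Space d => spread y l := by
  unfold spread ensembleMean
  fun_prop

theorem measurable_step (hL : Measurable L) (i : Fin N) :
    Measurable fun p : (Fin d → ℝ) × (Fin N → Space d) => step β L γ p.1 p.2 i := by
  unfold step weightedMean
  fun_prop

theorem IsSolution.ae_isTrajectory (h : IsSolution P L β γ η X) :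
    ∀ᵐ ω ∂P, IsTrajectory L β γ (fun n l => η n l ω) (fun n i => X n i ω) :=
  h.mono fun _ hω n => funext (hω n)

theorem IsSolution.aemeasurable (h : IsSolution P L β γ η X) (hL : Measurable L)
    (hη : ∀ n l, AEMeasurable (η n l) P) (h0 : ∀ i, AEMeasurable (X 0 i) P) (n : ℕ) (i : Fin N) :
    AEMeasurable (X n i) P := by
  induction n generalizing i with
  | zero => exact h0 i
  | succ n ih =>
    have hstep := (measurable_step (β := β) (γ := γ) hL i).comp_aemeasurable
      ((aemeasurable_pi_lambda _ (hη n)).prodMk (aemeasurable_pi_lambda _ ih))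
    exact hstep.congr (h.mono fun ω hω => (hω n i).symm)

end Measurability

section InitialSpread

variable {d N : ℕ} {Ω : Type*} [MeasurableSpace Ω] {P : Measure Ω}

theorem initialSpread_nonneg (X₀ : Fin N → Ω → Space d) : 0 ≤ initialSpread P X₀ :=
  Finset.sum_nonneg fun l _ => integral_nonneg fun ω => spread_nonneg (fun i => X₀ i ω) l

theorem norm_ensembleMean_le {y : Fin N → Space d} {R : ℝ} (hN : 0 < N) (hy : ∀ i, ‖y i‖ ≤ R) :
    ‖ensembleMean y‖ ≤ R := by
  rw [ensembleMean, norm_smul, norm_inv, Real.norm_natCast, inv_mul_le_iff₀ (by positivity)]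
  simpa using norm_sum_le_of_le Finset.univ fun i _ => hy i

theorem spread_le_of_norm_le {y : Fin N → Space d} {R : ℝ} (hy : ∀ i, ‖y i‖ ≤ R) (l : Fin d) :
    spread y l ≤ (2 * R) ^ 2 := by
  refine Real.iSup_le (fun i => ?_) (sq_nonneg _)
  refine sq_le_sq.2 (le_trans ?_ (le_abs_self _))
  calc |y i l - ensembleMean y l| ≤ ‖y i - ensembleMean y‖ :=
        PiLp.norm_apply_le (y i - ensembleMean y) l
    _ ≤ ‖y i‖ + ‖ensembleMean y‖ := norm_sub_le _ _
    _ ≤ 2 * R := by linarith [hy i, norm_ensembleMean_le i.pos hy]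

theorem integrable_spread [IsFiniteMeasure P] {X₀ : Fin N → Ω → Space d} {R : ℝ}
    (hX₀ : ∀ i, AEMeasurable (X₀ i) P) (hR : ∀ i, ∀ᵐ ω ∂P, ‖X₀ i ω‖ ≤ R) (l : Fin d) :
    Integrable (fun ω => spread (fun i => X₀ i ω) l) P := by
  refine Integrable.of_bound (C := (2 * R) ^ 2)
    ((measurable_spread l).comp_aemeasurable (aemeasurable_pi_lambda _ hX₀)).aestronglyMeasurable ?_
  filter_upwards [ae_all_iff.2 hR] with ω hω
  rw [Real.norm_of_nonneg (spread_nonneg _ _)]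
  exact spread_le_of_norm_le hω l

end InitialSpread

section Consensus

variable {d N : ℕ} {L : Space d → ℝ} {Ω : Type*} [MeasurableSpace Ω] {P : Measure Ω}
  {β γ ζ s : ℝ} {η : ℕ → Fin d → Ω → ℝ} {X : ℕ → Fin N → Ω → Space d}

theorem IsSolution.stepBound_ae_eq (hX : IsSolution P L β γ η X) (hN : 0 < N) (n : ℕ) :
    (fun ω => stepBound γ s (fun l => η n l ω) fun i => X n i ω) =ᵐ[P] fun ω =>
      ∑ l, contraction γ (fun k => η k l ω) n ^ 2 * stepCost γ s (η n l ω) *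
        spread (fun i => X 0 i ω) l := by
  filter_upwards [hX.ae_isTrajectory] with ω hω
  refine Finset.sum_congr rfl fun l _ => ?_
  rw [hω.spread_eq hN]
  ring

theorem indepFun_contraction_sq_mul_stepCost_spread
    (hind : IndepFun (fun ω i => X 0 i ω) (fun ω (p : ℕ × Fin d) => η p.1 p.2 ω) P) (n : ℕ)
    (l : Fin d) :
    IndepFun (fun ω => contraction γ (fun k => η k l ω) n ^ 2 * stepCost γ s (η n l ω))
      (fun ω => spread (fun i => X 0 i ω) l) P := by
  have hmeas : Measurable fun e : ℕ × Fin d → ℝ =>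
      contraction γ (fun k => e (k, l)) n ^ 2 * stepCost γ s (e (n, l)) := by
    unfold contraction stepCost
    fun_prop
  exact hind.symm.comp hmeas (measurable_spread l)

variable [IsProbabilityMeasure P]

theorem integrable_contraction_sq_mul_stepCost_mul_spread
    (hη : ∀ l, WhiteNoise P ζ fun n => η n l)
    (hind : IndepFun (fun ω i => X 0 i ω) (fun ω (p : ℕ × Fin d) => η p.1 p.2 ω) P)
    (hspread : ∀ l, Integrable (fun ω => spread (fun i => X 0 i ω) l) P) (n : ℕ) (l : Fin d) :
    Integrable (fun ω => contraction γ (fun k => η k l ω) n ^ 2 * stepCost γ s (η n l ω) *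
      spread (fun i => X 0 i ω) l) P :=
  (indepFun_contraction_sq_mul_stepCost_spread hind n l).integrable_mul
    ((hη l).integrable_contraction_sq_mul_stepCost n) (hspread l)

theorem integrable_stepBound (hN : 0 < N) (hη : ∀ l, WhiteNoise P ζ fun n => η n l)
    (hind : IndepFun (fun ω i => X 0 i ω) (fun ω (p : ℕ × Fin d) => η p.1 p.2 ω) P)
    (hspread : ∀ l, Integrable (fun ω => spread (fun i => X 0 i ω) l) P)
    (hX : IsSolution P L β γ η X) (n : ℕ) :
    Integrable (fun ω => stepBound γ s (fun l => η n l ω) fun i => X n i ω) P :=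
  (integrable_finsetSum _ fun l _ => integrable_contraction_sq_mul_stepCost_mul_spread hη hind
    hspread n l).congr (hX.stepBound_ae_eq hN n).symm

theorem integral_stepBound (hN : 0 < N) (hη : ∀ l, WhiteNoise P ζ fun n => η n l)
    (hind : IndepFun (fun ω i => X 0 i ω) (fun ω (p : ℕ × Fin d) => η p.1 p.2 ω) P)
    (hspread : ∀ l, Integrable (fun ω => spread (fun i => X 0 i ω) l) P)
    (hX : IsSolution P L β γ η X) (n : ℕ) :
    ∫ ω, stepBound γ s (fun l => η n l ω) (fun i => X n i ω) ∂P
      = ((1 - γ) ^ 2 + ζ ^ 2) ^ n * (meanStepCost γ ζ s * initialSpread P (X 0)) := by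
  rw [integral_congr_ae (hX.stepBound_ae_eq hN n), integral_finsetSum _ fun l _ =>
    integrable_contraction_sq_mul_stepCost_mul_spread hη hind hspread n l, ← mul_assoc,
    initialSpread, Finset.mul_sum]
  refine Finset.sum_congr rfl fun l _ => ?_
  rw [← (hη l).integral_contraction_sq_mul_stepCost]
  exact (indepFun_contraction_sq_mul_stepCost_spread hind n l).integral_fun_mul_eq_mul_integral
    ((hη l).integrable_contraction_sq_mul_stepCost n).aestronglyMeasurable
    (hspread l).aestronglyMeasurable

theorem ae_exists_tendsto (hN : 0 < N) (hρ : (1 - γ) ^ 2 + ζ ^ 2 < 1)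
    (hη : ∀ l, WhiteNoise P ζ fun n => η n l)
    (hind : IndepFun (fun ω i => X 0 i ω) (fun ω (p : ℕ × Fin d) => η p.1 p.2 ω) P)
    (hspread : ∀ l, Integrable (fun ω => spread (fun i => X 0 i ω) l) P)
    (hX : IsSolution P L β γ η X) :
    ∀ᵐ ω ∂P, ∃ z, ∀ i, Tendsto (fun n => X n i ω) atTop (𝓝 z) := by
  have hsum : ∀ᵐ ω ∂P, Summable fun n =>
      √(stepBound γ 1 (fun l => η n l ω) fun i => X n i ω) := by
    refine ae_summable_sqrt (fun n ω => stepBound_nonneg one_pos _ _)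
      (integrable_stepBound hN hη hind hspread hX) ?_
    simp only [integral_stepBound hN hη hind hspread hX]
    exact summable_sqrt_geometric_mul (by positivity) hρ _
  filter_upwards [hsum, hX.ae_isTrajectory] with ω hω htraj
  exact htraj.exists_tendsto hN one_pos hω

theorem exists_measurable_tendsto (hL : Measurable L) (hN : 0 < N)
    (hρ : (1 - γ) ^ 2 + ζ ^ 2 < 1) (hη : ∀ l, WhiteNoise P ζ fun n => η n l)
    (h0 : ∀ i, AEMeasurable (X 0 i) P)
    (hind : IndepFun (fun ω i => X 0 i ω) (fun ω (p : ℕ × Fin d) => η p.1 p.2 ω) P)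
    (hspread : ∀ l, Integrable (fun ω => spread (fun i => X 0 i ω) l) P)
    (hX : IsSolution P L β γ η X) :
    ∃ Xinf : Ω → Space d, Measurable Xinf ∧
      ∀ i, ∀ᵐ ω ∂P, Tendsto (fun n => X n i ω) atTop (𝓝 (Xinf ω)) := by
  have hlim := ae_exists_tendsto hN hρ hη hind hspread hX
  have hmeas := hX.aemeasurable hL
    (fun n l => ((hη l).memLp n).aestronglyMeasurable.aemeasurable) h0
  obtain ⟨Z, hZ, hZlim⟩ := measurable_limit_of_tendsto_metrizable_ae
    (fun n => hmeas n ⟨0, hN⟩) (hlim.mono fun ω h => h.imp fun z hz => hz ⟨0, hN⟩)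
  refine ⟨Z, hZ, fun i => ?_⟩
  filter_upwards [hlim, hZlim] with ω ⟨z, hz⟩ hZω
  exact tendsto_nhds_unique (hz _) hZω ▸ hz i

end Consensus

section MeanWeight

variable {d N : ℕ} {L : Space d → ℝ} {Ω : Type*} [MeasurableSpace Ω] {P : Measure Ω}
  {β m : ℝ}

theorem norm_meanWeight_le (hβ : 0 ≤ β) (hN : 0 < N) (hm : ∀ x, m ≤ L x) (y : Fin N → Space d) :
    ‖meanWeight β L y‖ ≤ Real.exp (-β * m) := by
  rw [meanWeight, norm_mul, norm_inv, Real.norm_natCast, inv_mul_le_iff₀ (by positivity)]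
  have hle : ∀ i, ‖Real.exp (-β * L (y i))‖ ≤ Real.exp (-β * m) := fun i => by
    rw [Real.norm_of_nonneg (Real.exp_pos _).le, Real.exp_le_exp]
    nlinarith [hm (y i)]
  simpa using norm_sum_le_of_le Finset.univ fun i _ => hle i

theorem meanWeight_const (hN : 0 < N) (x : Space d) :
    meanWeight β L (fun _ : Fin N => x) = Real.exp (-β * L x) := by
  have : (N : ℝ) ≠ 0 := by positivity
  simp [meanWeight, this]

theorem continuous_meanWeight (hL : Continuous L) :
    Continuous fun y : Fin N → Space d => meanWeight β L y := by
  unfold meanWeight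
  fun_prop

theorem integrable_meanWeight [IsFiniteMeasure P] (hβ : 0 ≤ β) (hN : 0 < N) (hL : Continuous L)
    (hm : ∀ x, m ≤ L x) {Y : Fin N → Ω → Space d} (hY : ∀ i, AEMeasurable (Y i) P) :
    Integrable (fun ω => meanWeight β L fun i => Y i ω) P :=
  Integrable.of_bound ((continuous_meanWeight hL).measurable.comp_aemeasurable
    (aemeasurable_pi_lambda _ hY)).aestronglyMeasurable _
    (Eventually.of_forall fun _ => norm_meanWeight_le hβ hN hm _)

theorem integral_meanWeight_of_identDistrib [IsFiniteMeasure P] {Ω₀ : Type*}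
    [MeasurableSpace Ω₀] {P₀ : Measure Ω₀} {Y₀ : Ω₀ → Space d} {Y : Fin N → Ω → Space d}
    (hβ : 0 ≤ β) (hN : 0 < N) (hL : Measurable L) (hm : ∀ x, m ≤ L x)
    (hY : ∀ i, IdentDistrib (Y i) Y₀ P P₀) :
    ∫ ω, meanWeight β L (fun i => Y i ω) ∂P = ∫ ω, Real.exp (-β * L (Y₀ ω)) ∂P₀ := by
  have hN' : (N : ℝ) ≠ 0 := by positivity
  have hexp : Measurable fun x => Real.exp (-β * L x) := by fun_prop
  have hident : ∀ i, ∫ ω, Real.exp (-β * L (Y i ω)) ∂P = ∫ ω, Real.exp (-β * L (Y₀ ω)) ∂P₀ :=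
    fun i => ((hY i).comp hexp).integral_eq
  have hint : ∀ i, Integrable (fun ω => Real.exp (-β * L (Y i ω))) P := fun i =>
    integrable_exp_neg_mul_of_le hβ (hL.comp_aemeasurable (hY i).aemeasurable_fst) fun ω =>
      hm (Y i ω)
  unfold meanWeight
  rw [integral_const_mul, integral_finsetSum _ fun i _ => hint i]
  simp only [hident, Finset.sum_const, Finset.card_univ, Fintype.card_fin, nsmul_eq_mul]
  exact inv_mul_cancel_left₀ hN' _

theorem tendsto_integral_meanWeight [IsFiniteMeasure P] {Y : ℕ → Fin N → Ω → Space d}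
    {Z : Ω → Space d} (hβ : 0 ≤ β) (hN : 0 < N) (hL : Continuous L) (hm : ∀ x, m ≤ L x)
    (hY : ∀ n i, AEMeasurable (Y n i) P)
    (hlim : ∀ i, ∀ᵐ ω ∂P, Tendsto (fun n => Y n i ω) atTop (𝓝 (Z ω))) :
    Tendsto (fun n => ∫ ω, meanWeight β L (fun i => Y n i ω) ∂P) atTop
      (𝓝 (∫ ω, Real.exp (-β * L (Z ω)) ∂P)) := by
  refine tendsto_integral_of_dominated_convergence (fun _ => Real.exp (-β * m))
    (fun n => (integrable_meanWeight hβ hN hL hm (hY n)).aestronglyMeasurable)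
    (integrable_const _) (fun n => Eventually.of_forall fun ω => norm_meanWeight_le hβ hN hm _) ?_
  filter_upwards [ae_all_iff.2 hlim] with ω hω
  rw [← meanWeight_const hN]
  exact ((continuous_meanWeight hL).tendsto _).comp (tendsto_pi_nhds.2 hω)

end MeanWeight

section LowerBound

variable {d N : ℕ} {L : Space d → ℝ} {Ω : Type*} [MeasurableSpace Ω] {P : Measure Ω}
  [IsProbabilityMeasure P] {β γ ζ s m : ℝ} {K : NNReal} {η : ℕ → Fin d → Ω → ℝ}
  {X : ℕ → Fin N → Ω → Space d}

theorem integral_meanWeight_sub_succ_le (hL : Differentiable ℝ L)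
    (hLip : LipschitzWith K (fderiv ℝ L)) (hm : ∀ x, m ≤ L x) (hβ : 0 ≤ β) (hN : 0 < N)
    (hs : 0 < s) (hη : ∀ l, WhiteNoise P ζ fun n => η n l) (h0 : ∀ i, AEMeasurable (X 0 i) P)
    (hind : IndepFun (fun ω i => X 0 i ω) (fun ω (p : ℕ × Fin d) => η p.1 p.2 ω) P)
    (hspread : ∀ l, Integrable (fun ω => spread (fun i => X 0 i ω) l) P)
    (hX : IsSolution P L β γ η X) (n : ℕ) :
    ∫ ω, meanWeight β L (fun i => X n i ω) ∂P - ∫ ω, meanWeight β L (fun i => X (n + 1) i ω) ∂P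
      ≤ ((1 - γ) ^ 2 + ζ ^ 2) ^ n *
        (2 * β * K * Real.exp (-β * m) * (meanStepCost γ ζ s * initialSpread P (X 0))) := by
  have hint : ∀ n, Integrable (fun ω => meanWeight β L fun i => X n i ω) P := fun n =>
    integrable_meanWeight hβ hN hL.continuous hm (hX.aemeasurable hL.continuous.measurable
      (fun n l => ((hη l).memLp n).aestronglyMeasurable.aemeasurable) h0 n)
  rw [← integral_sub (hint n) (hint (n + 1)), mul_left_comm,
    ← integral_stepBound hN hη hind hspread hX, ← integral_const_mul]
  refine integral_mono_ae ((hint n).sub (hint (n + 1)))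
    ((integrable_stepBound hN hη hind hspread hX n).const_mul _) ?_
  filter_upwards [hX.ae_isTrajectory] with ω hω
  simpa only [hω n] using meanWeight_sub_meanWeight_step_le hL hLip hm hβ hN hs

theorem integral_exp_sub_le_integral_exp_limit {Ω₀ : Type*} [MeasurableSpace Ω₀]
    {P₀ : Measure Ω₀} {Xin : Ω₀ → Space d} {Xinf : Ω → Space d} (hL : Differentiable ℝ L)
    (hLip : LipschitzWith K (fderiv ℝ L)) (hm : ∀ x, m ≤ L x) (hβ : 0 ≤ β) (hN : 0 < N)
    (hρ : (1 - γ) ^ 2 + ζ ^ 2 < 1) (hη : ∀ l, WhiteNoise P ζ fun n => η n l)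
    (h0 : ∀ i, IdentDistrib (X 0 i) Xin P P₀)
    (hind : IndepFun (fun ω i => X 0 i ω) (fun ω (p : ℕ × Fin d) => η p.1 p.2 ω) P)
    (hspread : ∀ l, Integrable (fun ω => spread (fun i => X 0 i ω) l) P)
    (hX : IsSolution P L β γ η X)
    (hlim : ∀ i, ∀ᵐ ω ∂P, Tendsto (fun n => X n i ω) atTop (𝓝 (Xinf ω))) :
    ∫ ω, Real.exp (-β * L (Xin ω)) ∂P₀ -
        2 * K * √((1 + (1 - γ) ^ 2 + ζ ^ 2) * (γ ^ 2 + ζ ^ 2)) * β * Real.exp (-β * m) /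
          (1 - ((1 - γ) ^ 2 + ζ ^ 2)) * initialSpread P (X 0)
      ≤ ∫ ω, Real.exp (-β * L (Xinf ω)) ∂P := by
  have hq : 0 < γ ^ 2 + ζ ^ 2 := by nlinarith [sq_nonneg ζ, sq_nonneg γ]
  obtain ⟨s, hs, hcost⟩ := exists_half_mul_add_div_eq_sqrt_mul
    (a := 1 + ((1 - γ) ^ 2 + ζ ^ 2)) (by positivity) hq
  have hmeas : ∀ i, AEMeasurable (X 0 i) P := fun i => (h0 i).aemeasurable_fst
  have hmeanCost := meanStepCost_nonneg (γ := γ) (ζ := ζ) hs.le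
  have hspread₀ := initialSpread_nonneg (P := P) (X 0)
  have hbound := sub_div_one_sub_le_of_tendsto (by positivity) (by positivity) hρ
    (integral_meanWeight_sub_succ_le hL hLip hm hβ hN hs hη hmeas hind hspread hX)
    (tendsto_integral_meanWeight hβ hN hL.continuous hm (hX.aemeasurable hL.continuous.measurable
      (fun n l => ((hη l).memLp n).aestronglyMeasurable.aemeasurable) hmeas) hlim)
  rw [integral_meanWeight_of_identDistrib hβ hN hL.continuous.measurable hm h0, meanStepCost,
    hcost, ← add_assoc] at hbound
  refine le_trans (le_of_eq ?_) hbound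
  ring

end LowerBound

section Consensus

variable {d N : ℕ} {L : Space d → ℝ} {Xstar : Space d} {Ω₀ : Type*} [MeasurableSpace Ω₀]
  {P₀ : Measure Ω₀} {Xin : Ω₀ → Space d} {f : Space d → ℝ}

theorem minValue_eq_of_forall_le (h : ∀ x, L Xstar ≤ L x) : minValue L = L Xstar :=
  le_antisymm (ciInf_le ⟨L Xstar, Set.forall_mem_range.2 h⟩ Xstar) (le_ciInf h)

namespace ReferenceLaw

theorem isBigO_freeEnergy_error [IsFiniteMeasure P₀] (h : ReferenceLaw P₀ Xin f Xstar)
    (hL : ContDiff ℝ 2 L) (hmin : ∀ x, x ≠ Xstar → L Xstar < L x)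
    (hdet : (hessian L Xstar).det ≠ 0) (a : ℝ) :
    (fun β => freeEnergy P₀ (fun ω => L (Xin ω)) β - 1 / β * a
      - (L Xstar + d / 2 * (Real.log β / β))) =O[atTop] fun β => 1 / β := by
  have hlog : (fun β : ℝ => a * (1 / β)) =O[atTop] fun β => 1 / β :=
    isBigO_const_mul_self a _ _
  refine ((isBigO_freeEnergy_sub (h.isTheta_integral_exp hL hmin hdet)).sub hlog).congr_left
    fun β => ?_
  ring

theorem integral_exp_neg_mul_pos [IsProbabilityMeasure P₀] (h : ReferenceLaw P₀ Xin f Xstar)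
    (hL : Continuous L) (hmin : ∀ x, L Xstar ≤ L x) {β : ℝ} (hβ : 0 ≤ β) :
    0 < ∫ ω, Real.exp (-β * L (Xin ω)) ∂P₀ :=
  integral_exp_pos <| integrable_exp_neg_mul_of_le hβ
    (hL.measurable.comp h.measurable_var).aemeasurable fun ω => hmin (Xin ω)

theorem integrable_spread_of_identDistrib (h : ReferenceLaw P₀ Xin f Xstar) {Ω : Type*}
    [MeasurableSpace Ω] {P : Measure Ω} [IsFiniteMeasure P] {X₀ : Fin N → Ω → Space d}
    (h0 : ∀ i, IdentDistrib (X₀ i) Xin P P₀) (l : Fin d) :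
    Integrable (fun ω => spread (fun i => X₀ i ω) l) P := by
  obtain ⟨R, hR⟩ := h.exists_ae_norm_le
  exact integrable_spread (fun i => (h0 i).aemeasurable_fst) (fun i => (h0 i).symm.ae_snd
    (p := fun x => ‖x‖ ≤ R) (measurableSet_le measurable_norm measurable_const) hR) l

end ReferenceLaw

theorem exists_limit_mul_integral_exp_le (hL : ContDiff ℝ 2 L)
    (hbdd : BddAbove (Set.range fun x => spectralNorm (hessian L x)))
    (hmin : ∀ x, L Xstar ≤ L x) (hXin : ReferenceLaw P₀ Xin f Xstar) {Ω : Type*}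
    [MeasurableSpace Ω] {P : Measure Ω} [IsProbabilityMeasure P] {β γ ζ ε : ℝ}
    {η : ℕ → Fin d → Ω → ℝ} {X : ℕ → Fin N → Ω → Space d} (hβ : 0 ≤ β) (hN : 0 < N)
    (hρ : (γ - 1) ^ 2 + ζ ^ 2 < 1) (hη : ∀ l, WhiteNoise P ζ fun n => η n l)
    (h0 : ∀ i, IdentDistrib (X 0 i) Xin P P₀)
    (hind : IndepFun (fun ω i => X 0 i ω) (fun ω (p : ℕ × Fin d) => η p.1 p.2 ω) P)
    (hX : IsSolution P L β γ η X)
    (hcond : 2 * hessianBound L * √((1 + (1 - γ) ^ 2 + ζ ^ 2) * (γ ^ 2 + ζ ^ 2)) * β *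
        Real.exp (-β * minValue L) / (1 - ((γ - 1) ^ 2 + ζ ^ 2)) * initialSpread P (X 0)
      ≤ (1 - ε) * ∫ ω, Real.exp (-β * L (Xin ω)) ∂P₀) :
    ∃ Xinf : Ω → Space d, Measurable Xinf ∧
      (∀ i, ∀ᵐ ω ∂P, Tendsto (fun n => X n i ω) atTop (𝓝 (Xinf ω))) ∧
      ε * ∫ ω, Real.exp (-β * L (Xin ω)) ∂P₀ ≤ ∫ ω, Real.exp (-β * L (Xinf ω)) ∂P := by
  rw [sub_sq_comm] at hρ
  have hspread := hXin.integrable_spread_of_identDistrib h0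
  obtain ⟨Xinf, hmeas, hlim⟩ := exists_measurable_tendsto hL.continuous.measurable hN hρ hη
    (fun i => (h0 i).aemeasurable_fst) hind hspread hX
  refine ⟨Xinf, hmeas, hlim, ?_⟩
  have hbound := integral_exp_sub_le_integral_exp_limit (hL.differentiable (by norm_num))
    (lipschitzWith_fderiv hL hbdd) hmin hβ hN hρ hη h0 hind hspread hX hlim
  rw [Real.coe_toNNReal _ hessianBound_nonneg, ← minValue_eq_of_forall_le hmin,
    sub_sq_comm 1 γ] at hbound
  rw [sub_sq_comm 1 γ] at hcond
  linarith

theorem essInf_mem_Icc_of_mul_integral_exp_le (hL : Continuous L) (hmin : ∀ x, L Xstar ≤ L x)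
    [IsProbabilityMeasure P₀] (hXin : ReferenceLaw P₀ Xin f Xstar) {Ω : Type*}
    [MeasurableSpace Ω] {P : Measure Ω} [IsProbabilityMeasure P] {Z : Ω → Space d} {β ε : ℝ}
    (hβ : 0 < β) (hε : 0 < ε)
    (h : ε * ∫ ω, Real.exp (-β * L (Xin ω)) ∂P₀ ≤ ∫ ω, Real.exp (-β * L (Z ω)) ∂P) :
    essInf (fun ω => L (Z ω)) P ∈
      Set.Icc (L Xstar) (freeEnergy P₀ (fun ω => L (Xin ω)) β - 1 / β * Real.log ε) := by
  have hpos := hXin.integral_exp_neg_mul_pos hL hmin hβ.le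
  exact Set.Icc_subset_Icc_right (freeEnergy_le_sub_log hβ.le hε hpos h)
    (essInf_mem_Icc_freeEnergy hβ ((mul_pos hε hpos).trans_le h)
      (Eventually.of_forall fun ω => hmin (Z ω)))

theorem div_one_sub_le_div_one_sub_exp {a r : ℝ} (ha : 0 ≤ a) (hr : r < 1) :
    a / (1 - r) ≤ a / (1 - Real.exp (-(1 - r))) := by
  refine div_le_div_of_nonneg_left ha ?_ ?_
  · exact sub_pos.2 (Real.exp_lt_one_iff.2 (by linarith))
  · linarith [Real.add_one_le_exp (-(1 - r))]

end Consensus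

end CBO

end

theorem theorem3p2_general {d : ℕ} {L : CBO.Space d → ℝ} {Xstar : CBO.Space d}
    (hL : ContDiff ℝ 2 L)
    (hbdd : BddAbove (Set.range fun x => CBO.spectralNorm (CBO.hessian L x)))
    (hmin : ∀ x, x ≠ Xstar → L Xstar < L x) (hdet : (CBO.hessian L Xstar).det ≠ 0)
    {Ω₀ : Type*} [MeasurableSpace Ω₀] {P₀ : Measure Ω₀} [IsProbabilityMeasure P₀]
    {Xin : Ω₀ → CBO.Space d} {f : CBO.Space d → ℝ} (hXin : CBO.ReferenceLaw P₀ Xin f Xstar)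
    {ε : ℝ} (hε : 0 < ε) :
    ∃ E : ℝ → ℝ,
      E =O[atTop] (fun β : ℝ => 1 / β) ∧
      (∀ β : ℝ, 0 < β →
        -(1 / β) * Real.log (∫ ω, Real.exp (-β * L (Xin ω)) ∂P₀) - (1 / β) * Real.log ε
          = L Xstar + (d : ℝ) / 2 * (Real.log β / β) + E β) ∧
      ∀ (β γ ζ : ℝ) (N : ℕ) (Ω : Type*) [MeasurableSpace Ω] (P : Measure Ω)
        [IsProbabilityMeasure P] (η : ℕ → Fin d → Ω → ℝ) (X : ℕ → Fin N → Ω → CBO.Space d),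
        0 < β → 0 < N → (γ - 1) ^ 2 + ζ ^ 2 < 1 →
        (∀ l, CBO.WhiteNoise P ζ fun n => η n l) →
        (∀ i, IdentDistrib (X 0 i) Xin P P₀) →
        IndepFun (fun ω i => X 0 i ω) (fun ω (p : ℕ × Fin d) => η p.1 p.2 ω) P →
        CBO.IsSolution P L β γ η X →
        (1 - ε) * ∫ ω, Real.exp (-β * L (Xin ω)) ∂P₀ ≥
          2 * CBO.hessianBound L * √((1 + (1 - γ) ^ 2 + ζ ^ 2) * (γ ^ 2 + ζ ^ 2)) * β *
              Real.exp (-β * CBO.minValue L) / (1 - ((γ - 1) ^ 2 + ζ ^ 2)) *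
            CBO.initialSpread P (X 0) →
        ∃ Xinf : Ω → CBO.Space d, Measurable Xinf ∧
          (∀ i, ∀ᵐ ω ∂P, Tendsto (fun n => X n i ω) atTop (𝓝 (Xinf ω))) ∧
          essInf (fun ω => L (Xinf ω)) P ≤
            -(1 / β) * Real.log (∫ ω, Real.exp (-β * L (Xin ω)) ∂P₀)
              - (1 / β) * Real.log ε ∧
          |essInf (fun ω => L (Xinf ω)) P - L Xstar| ≤
            (d : ℝ) / 2 * (Real.log β / β) + E β := by
  have hle := CBO.le_of_forall_ne_lt hmin
  refine ⟨_, hXin.isBigO_freeEnergy_error hL hmin hdet (Real.log ε), fun β _ => ?_, ?_⟩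
  · rw [CBO.freeEnergy]
    ring
  intro β γ ζ N Ω _ P _ η X hβ hN hρ hη h0 hind hX hcond
  obtain ⟨Xinf, hmeas, hlim, hweight⟩ :=
    CBO.exists_limit_mul_integral_exp_le hL hbdd hle hXin hβ.le hN hρ hη h0 hind hX hcond
  obtain ⟨hlow, hup⟩ :=
    CBO.essInf_mem_Icc_of_mul_integral_exp_le hL.continuous hle hXin hβ hε hweight
  refine ⟨Xinf, hmeas, hlim, hup, ?_⟩
  rw [abs_of_nonneg (sub_nonneg.2 hlow)]
  linarith

theorem theorem3p2 {d : ℕ} (L : CBO.Space d → ℝ) (Xstar : CBO.Space d)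
    (hL : CBO.Objective L Xstar)
    {Ω₀ : Type*} [MeasurableSpace Ω₀] (P₀ : Measure Ω₀) [IsProbabilityMeasure P₀]
    (Xin : Ω₀ → CBO.Space d) (f : CBO.Space d → ℝ)
    (hXin : CBO.ReferenceLaw P₀ Xin f Xstar)
    (ε : ℝ) (hε₀ : 0 < ε) (hε₁ : ε < 1) :
    ∃ E : ℝ → ℝ,
      E =O[atTop] (fun β : ℝ => 1 / β) ∧
      (∀ β : ℝ, 0 < β →
        -(1 / β) * Real.log (∫ ω, Real.exp (-β * L (Xin ω)) ∂P₀) - (1 / β) * Real.log ε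
          = L Xstar + (d : ℝ) / 2 * (Real.log β / β) + E β) ∧
      ∀ (β γ ζ : ℝ) (N : ℕ) (Ω : Type*) [MeasurableSpace Ω] (P : Measure Ω)
        [IsProbabilityMeasure P] (η : ℕ → Fin d → Ω → ℝ) (X : ℕ → Fin N → Ω → CBO.Space d),
        0 < β → 0 < N → (γ - 1) ^ 2 + ζ ^ 2 < 1 →
        CBO.Noise P ζ η →
        CBO.InitialData P P₀ Xin η (X 0) →
        CBO.IsSolution P L β γ η X →
        (1 - ε) * ∫ ω, Real.exp (-β * L (Xin ω)) ∂P₀ ≥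
          2 * CBO.hessianBound L * √((1 + (1 - γ) ^ 2 + ζ ^ 2) * (γ ^ 2 + ζ ^ 2)) * β *
              Real.exp (-β * CBO.minValue L) / (1 - Real.exp (-(1 - (γ - 1) ^ 2 - ζ ^ 2))) *
            CBO.initialSpread P (X 0) →
        ∃ Xinf : Ω → CBO.Space d, Measurable Xinf ∧
          (∀ i, ∀ᵐ ω ∂P, Tendsto (fun n => X n i ω) atTop (𝓝 (Xinf ω))) ∧
          essInf (fun ω => L (Xinf ω)) P ≤
            -(1 / β) * Real.log (∫ ω, Real.exp (-β * L (Xin ω)) ∂P₀)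
              - (1 / β) * Real.log ε ∧
          |essInf (fun ω => L (Xinf ω)) P - L Xstar| ≤
            (d : ℝ) / 2 * (Real.log β / β) + E β := by
  obtain ⟨E, hE, hfree, hconv⟩ := theorem3p2_general hL.contDiff hL.hessian_bdd hL.unique_min
    hL.det_pos.ne' hXin hε₀
  refine ⟨E, hE, hfree, fun β γ ζ N Ω _ P _ η X hβ hN hρ hη h0 hX hcond => ?_⟩
  refine hconv β γ ζ N Ω P η X hβ hN hρ hη.whiteNoise h0.ident h0.indep_noise hX (hcond.trans' ?_)
  have hbound := CBO.hessianBound_nonneg (L := L)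
  rw [sub_sub]
  exact mul_le_mul_of_nonneg_right (CBO.div_one_sub_le_div_one_sub_exp (by positivity) hρ)
    (CBO.initialSpread_nonneg _)
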